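/- Let $G=(V,E)$ be a finite simple graph, let $B\subseteq V$, and let $\gamma\in\{-1,1\}^B$ be fixed (independent of the disorder). For $J=(J_e)_{e\in E}\in\mathbb{R}^E$ and $\sigma\in\{-1,1\}^V$ put $H_J(\sigma)=-\sum_{\{i,j\}\in E}J_{ij}\sigma_i\sigma_j$. A ground state in the environment $J$ under the boundary condition $\gamma$ on $B$ is a minimizer of $H_J(\sigma)$ among all $\sigma$ with $\sigma_i=\gamma_i$ for every $i\in B$; for $B=\emptyset$ there is no constraint (free boundary). Let $J$ and $J'$ be two independent families of i.i.d. standard Gaussian random variables indexed by $E$, and let $p\in(0,1)$. The perturbed environment $J^{(p)}$ is obtained from $J$ in one of two ways: (1) $J^{(p)}_e=(1-p)J_e+\sqrt{2p-p^2}\,J'_e$ for every $e\in E$; or (2) each $J_e$ is replaced by $J'_e$ with probability $p$ and kept with probability $1-p$, independently over $e\in E$ and independently of $(J,J')$. Let $\sigma$ and $\sigma'$ be ground states in the environments $J$ and $J^{(p)}$, respectively, under the same boundary condition, and let $V^\circ=V\setminus B$ and $$R(p)=\frac1{|V^\circ|}\sum_{i\in V^\circ}\sigma_i\sigma'_i .$$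 (In the cases below the ground state is almost surely unique if $B\neq\emptyset$, and almost surely unique up to a global sign if $B=\emptyset$, so that $R(p)^2$ is almost surely well defined.) For every $d\ge1$ there is a constant $C(d)>0$, depending only on $d$, such that for both kinds of perturbations and all $p\in(0,1)$ the following hold. (a) Let $L\ge2$, let $G$ be the cube $\{0,1,\ldots,L\}^d$ with nearest-neighbor edges, let $B$ be the set of vertices having at least one coordinate equal to $0$ or $L$, and let $\gamma\in\{-1,1\}^B$ be any fixed boundary condition. Then $$\mathbb{E}(R(p)^2)\le\begin{cases}C(d)L^{-1}p^{-1}&\text{if } d=1,\\ C(d)L^{-2}p^{-2}&\text{if } d\ge2.\end{cases}$$ (b) Let $L\ge1$, and let $G$ be either the cube $\{0,1,\ldots,L\}^d$ with nearest-neighbor edges, or the simple graph obtained from this cube by identifying the vertices on opposite faces (periodic boundary; that is, the discrete torus $(\mathbb{Z}/L\mathbb{Z})^d$, without loops or multiple edges), and let $B=\emptyset$. Then $$\mathbb{E}(R(p)^2)\le\frac{C(d)}{L^dp^d}.$$ -/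

import Mathlib

open MeasureTheory ProbabilityTheory

noncomputable section

namespace EdwardsAnderson

/-- The Edwards–Anderson Hamiltonian `H_J(σ) = - ∑_{{i,j} ∈ E} J_{ij} σ_i σ_j`. Spins are elements
of `ℤˣ = {1, -1}` and the environment `J` is indexed by the edges of `G`. -/
def hamiltonian {V : Type*} (G : SimpleGraph V) [Fintype G.edgeSet]
    (J : G.edgeSet → ℝ) (σ : V → ℤˣ) : ℝ :=
  -∑ e : G.edgeSet, J e * (((Sym2.mul (Sym2.map σ e.1) : ℤˣ) : ℤ) : ℝ)

/-- `σ` is a ground state in the environment `J` under the boundary condition `γ` on `B`: it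
minimizes the Hamiltonian among all configurations that agree with `γ` on `B`.
For `B = ∅` this is a ground state under the free boundary condition. -/
def IsGroundState {V : Type*} (G : SimpleGraph V) [Fintype G.edgeSet]
    (B : Finset V) (γ : B → ℤˣ) (J : G.edgeSet → ℝ) (σ : V → ℤˣ) : Prop :=
  (∀ i : B, σ i = γ i) ∧
    ∀ τ : V → ℤˣ, (∀ i : B, τ i = γ i) → hamiltonian G J σ ≤ hamiltonian G J τ

/-- The site overlap `|V \ B|⁻¹ ∑_{i ∈ V \ B} σ_i σ'_i`. -/
def siteOverlap {V : Type*} [Fintype V] [DecidableEq V] (B : Finset V) (σ σ' : V → ℤˣ) : ℝ :=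
  (∑ i ∈ Bᶜ, (((σ i * σ' i : ℤˣ) : ℤ) : ℝ)) / (Bᶜ.card : ℝ)

/-- First kind of perturbation: `J` is a family of i.i.d. standard Gaussian variables and
`K_e = (1 - p) J_e + √(2p - p²) J'_e`, where `J'` is an independent copy of `J`. -/
def IsGaussianPerturbation {Ω : Type*} [MeasurableSpace Ω] (P : Measure Ω)
    {E : Type*} [Fintype E] (p : unitInterval) (J K : Ω → E → ℝ) : Prop :=
  ∃ J' : Ω → E → ℝ,
    HasLaw (fun ω e => (J ω e, J' ω e))
      (Measure.pi fun _ : E => (gaussianReal 0 1).prod (gaussianReal 0 1)) P ∧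
    ∀ ω e, K ω e = (1 - (p : ℝ)) * J ω e + Real.sqrt (2 * (p : ℝ) - (p : ℝ) ^ 2) * J' ω e

/-- Second kind of perturbation: `J` is a family of i.i.d. standard Gaussian variables and each
`J_e` is replaced by `J'_e` with probability `p`, independently of each other, where `J'` is an
independent copy of `J`; the event that `J_e` is replaced is `ξ_e = true`. -/
def IsResamplingPerturbation {Ω : Type*} [MeasurableSpace Ω] (P : Measure Ω)
    {E : Type*} [Fintype E] (p : unitInterval) (J K : Ω → E → ℝ) : Prop :=
  ∃ (J' : Ω → E → ℝ) (ξ : Ω → E → Bool),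
    HasLaw (fun ω e => (J ω e, J' ω e, ξ ω e))
      (Measure.pi fun _ : E =>
        (gaussianReal 0 1).prod ((gaussianReal 0 1).prod (bernoulliMeasure true false p))) P ∧
    ∀ ω e, K ω e = if ξ ω e = true then J' ω e else J ω e

/-- `E(R(p)²) ≤ b` for both kinds of perturbations with parameter `p`, in the Edwards–Anderson
model on `G` with boundary condition `γ` on `B` (free boundary condition if `B = ∅`).
The bound is required for every choice of a ground state `σ` in the environment `J` and of a ground
state `σ'` in the perturbed environment `K` (no measurability of the choice is
assumed; for `B = ∅` there are always at least two choices in each environment). -/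
def OverlapSecondMomentLE.{u, v} {V : Type v} [Fintype V] [DecidableEq V] (G : SimpleGraph V)
    [Fintype G.edgeSet] (B : Finset V) (γ : B → ℤˣ) (p : unitInterval) (b : ℝ) : Prop :=
  ∀ (Ω : Type u) [MeasurableSpace Ω] (P : Measure Ω) [IsProbabilityMeasure P]
    (J K : Ω → G.edgeSet → ℝ) (σ σ' : Ω → V → ℤˣ),
    (IsGaussianPerturbation P p J K ∨ IsResamplingPerturbation P p J K) →
    (∀ᵐ ω ∂P, IsGroundState G B γ (J ω) (σ ω)) →
    (∀ᵐ ω ∂P, IsGroundState G B γ (K ω) (σ' ω)) →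
      Integrable (fun ω => siteOverlap B (σ ω) (σ' ω) ^ 2) P ∧
      ∫ ω, siteOverlap B (σ ω) (σ' ω) ^ 2 ∂P ≤ b

/-- The cube `{0, 1, …, L}^d` in `ℤ^d` with nearest-neighbour edges. -/
def cube (d L : ℕ) : SimpleGraph (Fin d → Fin (L + 1)) where
  Adj x y := ∃ k, ((x k : ℕ) + 1 = y k ∨ (y k : ℕ) + 1 = x k) ∧ ∀ l, l ≠ k → x l = y l
  symm := ⟨fun _ _ ⟨k, hk, h⟩ => ⟨k, hk.symm, fun l hl => (h l hl).symm⟩⟩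
  loopless := ⟨fun _ ⟨_, hk, _⟩ => by omega⟩

instance (d L : ℕ) : DecidableRel (cube d L).Adj := Classical.decRel _

/-- The usual boundary of the cube: the vertices with at least one coordinate equal to `0` or `L`. -/
def cubeBoundary (d L : ℕ) : Finset (Fin d → Fin (L + 1)) :=
  Finset.univ.filter fun x => ∃ k, x k = 0 ∨ x k = Fin.last L

/-- The cube `{0, 1, …, L}^d` with the vertices on opposite faces identified (the coordinates `0`
and `L` become equal), that is, the discrete torus `(ℤ/Lℤ)^d`, as a simple graph: `x` and `y` are
adjacent if and only if they are distinct and differ by `1` or `-1` in exactly one coordinate. -/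
def torus (d L : ℕ) : SimpleGraph (Fin d → ZMod L) where
  Adj x y := x ≠ y ∧ ∃ k, (x k + 1 = y k ∨ y k + 1 = x k) ∧ ∀ l, l ≠ k → x l = y l
  symm := ⟨fun _ _ ⟨hne, k, hk, h⟩ => ⟨hne.symm, k, hk.symm, fun l hl => (h l hl).symm⟩⟩
  loopless := ⟨fun _ h => h.1 rfl⟩

instance (d L : ℕ) : DecidableRel (torus d L).Adj := Classical.decRel _

end EdwardsAnderson

end

universe u

open MeasureTheory ProbabilityTheory

noncomputable section

namespace EdwardsAnderson

/-! Expanding the square of the overlap reduces everything to the two-point quantities `E f(J)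
f(K)`, where `f` is `σ_i σ_j` in the ground state, a function of the environment. The key bound is
`E f(J) f(K) ≤ q ^ m` with `q = 1 - p`, where `m` is a number of edges such that no set of fewer
than `m` edges joins `i` to `j` or joins both `i` and `j` to `B`.

The bound rests on gauge symmetry. If `A` is a set of fewer than `m` edges, let `τ` be `-1` on the
`A`-cluster of `i` (or of `j`) and `1` elsewhere. Multiplying `J_{xy}` by `τ_x τ_y` preserves the
Gaussian law, leaves the couplings in `A` alone, respects the boundary condition, and changes the
sign of `f`. Hence the part of the correlation carried by `A` vanishes. Under resampling, `A` is the
set of retained edges; under the Gaussian perturbation it indexes the expansion of the product of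
Mehler densities `∏ (1 + (M - 1))` (`resampleCorrelation_le_mul_pow`,
`exists_gaussianCorrelation_le_mul_pow`). This gives `C q ^ m` with `C` depending on the graph.

The constant is removed by a tensor-power argument: two conditionally independent perturbations of
one environment with parameter `q` are related to each other as with parameter `q ^ 2`, so
Cauchy–Schwarz gives `φ(q) ^ 2 ≤ φ(q ^ 2)` for the correlation `φ` (`sq_correlation_le`). Iterating
and taking `2 ^ k`-th roots turns `C` into `1`.

It remains to sum `q ^ m` over pairs. The bulk contributes order `(L p) ^ (-d)`; with a fixed
boundary, pairs close to it contribute order `(L p) ^ (-2)`. -/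

/-! ### Removing the constant from a power bound -/

theorem le_pow_of_sq_le_of_le_mul_pow {φ : unitInterval → ℝ} {m : ℕ} {C δ : ℝ} (hδ : 0 < δ)
    (hsq : ∀ q, 0 < q → q < 1 → φ q ^ 2 ≤ φ (q ^ 2))
    (hsmall : ∀ q : unitInterval, 0 < q → (q : ℝ) < δ → φ q ≤ C * (q : ℝ) ^ m)
    {q : unitInterval} (hq0 : 0 < q) (hq1 : q < 1) : φ q ≤ (q : ℝ) ^ m := by
  have hpos : ∀ k : ℕ, 0 < q ^ k := fun k => by
    have : (0 : ℝ) < (q : ℝ) ^ k := pow_pos (by exact_mod_cast hq0) k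
    exact_mod_cast this
  -- Raising to the power `2 ^ k` is applied only after a first squaring, so no sign condition on
  -- `φ` is needed.
  have iter : ∀ k : ℕ, ∀ r : unitInterval, 0 < r → r < 1 → φ r ^ (2 ^ k) ≤ φ (r ^ (2 ^ k)) := by
    intro k
    induction k with
    | zero => intro r _ _; simp
    | succ k ih =>
      intro r hr hr1
      have hr' : 0 < r ^ 2 := by
        have : (0 : ℝ) < (r : ℝ) ^ 2 := pow_pos (by exact_mod_cast hr) 2
        exact_mod_cast this
      have hr1' : r ^ 2 < 1 := by
        have : (r : ℝ) ^ 2 < 1 := pow_lt_one₀ r.2.1 (by exact_mod_cast hr1) two_ne_zero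
        exact_mod_cast this
      calc φ r ^ 2 ^ (k + 1) = (φ r ^ 2) ^ 2 ^ k := by rw [← pow_mul, pow_succ, mul_comm]
        _ ≤ φ (r ^ 2) ^ 2 ^ k := pow_le_pow_left₀ (sq_nonneg _) (hsq r hr hr1) _
        _ ≤ φ ((r ^ 2) ^ 2 ^ k) := ih _ hr' hr1'
        _ = φ (r ^ 2 ^ (k + 1)) := by rw [← pow_mul, pow_succ (2 : ℕ) k, mul_comm]
  -- If `φ q / q ^ m > 1`, its `2 ^ k`-th power eventually exceeds `C`, while `q ^ (2 ^ k)` drops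
  -- below `δ`, where the crude bound applies.
  by_contra! hlt
  have hq : (0 : ℝ) < (q : ℝ) ^ m := pow_pos (by exact_mod_cast hq0) m
  have h1 : 1 < φ q / (q : ℝ) ^ m := (one_lt_div hq).2 hlt
  have hpow : Filter.Tendsto (fun k : ℕ => 2 ^ k) Filter.atTop Filter.atTop :=
    tendsto_pow_atTop_atTop_of_one_lt one_lt_two
  have e1 := ((tendsto_pow_atTop_atTop_of_one_lt h1).comp hpow).eventually_gt_atTop C
  have e2 := ((tendsto_pow_atTop_nhds_zero_of_lt_one q.2.1
    (show (q : ℝ) < 1 by exact_mod_cast hq1)).comp hpow).eventually_lt_const hδ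
  obtain ⟨k, hk1, hk2⟩ := (e1.and e2).exists
  simp only [Function.comp_apply] at hk1 hk2
  have h2 := (iter k q hq0 hq1).trans (hsmall (q ^ 2 ^ k) (hpos _) (by exact_mod_cast hk2))
  rw [div_pow, lt_div_iff₀ (pow_pos hq _)] at hk1
  refine absurd h2 (not_le.2 ?_)
  convert hk1 using 2
  push_cast
  rw [← pow_mul, ← pow_mul, mul_comm]

/-! ### Product measures and Cauchy–Schwarz for noisy copies -/

section Pi

variable {E X Y Z Z' : Type*} [Fintype E] [MeasurableSpace X] [MeasurableSpace Y]
  [MeasurableSpace Z] [MeasurableSpace Z']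

theorem integral_pi_comp (μ : Measure X) [IsProbabilityMeasure μ] {φ : X → Y} (hφ : Measurable φ)
    {F : (E → Y) → ℝ} (hF : Measurable F) :
    ∫ w, F (fun e => φ (w e)) ∂(Measure.pi fun _ : E => μ) =
      ∫ u, F u ∂(Measure.pi fun _ : E => μ.map φ) := by
  have := Measure.isProbabilityMeasure_map (μ := μ) hφ.aemeasurable
  rw [← Measure.pi_map_pi (fun _ => hφ.aemeasurable),
    integral_map (Measurable.aemeasurable (by fun_prop)) hF.aestronglyMeasurable]

theorem integral_pi_prod (μ : Measure X) (ν : Measure Y) [IsProbabilityMeasure μ]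
    [IsProbabilityMeasure ν] (F : (E → X) × (E → Y) → ℝ) :
    ∫ w, F (fun e => (w e).1, fun e => (w e).2) ∂(Measure.pi fun _ : E => μ.prod ν) =
      ∫ u, F u ∂((Measure.pi fun _ : E => μ).prod (Measure.pi fun _ : E => ν)) :=
  (measurePreserving_arrowProdEquivProdArrow X Y E (fun _ => μ) (fun _ => ν)).integral_comp' F

theorem integrable_of_abs_le_one {Ω : Type*} [MeasurableSpace Ω] {P : Measure Ω}
    [IsFiniteMeasure P] {g : Ω → ℝ} (hg : AEStronglyMeasurable g P) (hb : ∀ ω, |g ω| ≤ 1) :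
    Integrable g P :=
  Integrable.of_bound hg 1 (Filter.Eventually.of_forall hb)

theorem abs_mul_le_one {a b : ℝ} (ha : |a| ≤ 1) (hb : |b| ≤ 1) : |a * b| ≤ 1 := by
  rw [abs_mul]; exact mul_le_one₀ ha (abs_nonneg _) hb

/-- Integrate `(f g - c) ^ 2 ≥ 0`, with `c` the integral of `f g`, and use `f ^ 2 ≤ 1`. -/
theorem sq_integral_mul_le {Ω : Type*} [MeasurableSpace Ω] {P : Measure Ω}
    [IsProbabilityMeasure P] {f g : Ω → ℝ} (hf : Measurable f) (hg : Measurable g)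
    (hfb : ∀ ω, |f ω| ≤ 1) (hgb : ∀ ω, |g ω| ≤ 1) :
    (∫ ω, f ω * g ω ∂P) ^ 2 ≤ ∫ ω, g ω * g ω ∂P := by
  set c := ∫ ω, f ω * g ω ∂P with hc
  have i1 : Integrable (fun ω => f ω * g ω) P :=
    integrable_of_abs_le_one (hf.mul hg).aestronglyMeasurable fun ω => abs_mul_le_one (hfb ω) (hgb ω)
  have i2 : Integrable (fun ω => g ω * g ω) P :=
    integrable_of_abs_le_one (hg.mul hg).aestronglyMeasurable fun ω => abs_mul_le_one (hgb ω) (hgb ω)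
  have h : ∫ ω, (2 * c * (f ω * g ω) - c ^ 2) ∂P ≤ ∫ ω, g ω * g ω ∂P := by
    refine integral_mono ((i1.const_mul _).sub (integrable_const _)) i2 fun ω => ?_
    have := sq_nonneg (f ω * g ω - c)
    have h1 : f ω ^ 2 ≤ 1 := (sq_le_one_iff_abs_le_one _).2 (hfb ω)
    have h2 : f ω ^ 2 * g ω ^ 2 ≤ g ω ^ 2 := mul_le_of_le_one_left (sq_nonneg _) h1
    simp only
    nlinarith
  rw [integral_sub (i1.const_mul _) (integrable_const _), integral_const_mul, ← hc] at h
  simp at h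
  linarith [sq c, h]

/-- If two conditionally independent copies of `T (x, z)` given `x` have the law of `(x, T' (x, z'))`
at every site, then `E f(x) f(T(x, z))` is bounded by the square root of `E f(x) f(T'(x, z'))`. -/
theorem sq_correlation_le {μ : Measure X} {ν : Measure Z} {ν' : Measure Z'}
    [IsProbabilityMeasure μ] [IsProbabilityMeasure ν] [IsProbabilityMeasure ν']
    {T : X × Z → X} {T' : X × Z' → X} (hT : Measurable T) (hT' : Measurable T')
    (h : (μ.prod (ν.prod ν)).map (fun w => (T (w.1, w.2.1), T (w.1, w.2.2))) =
      (μ.prod ν').map fun w => (w.1, T' w))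
    {f : (E → X) → ℝ} (hf : Measurable f) (hb : ∀ x, |f x| ≤ 1) :
    (∫ w, f (fun e => (w e).1) * f (fun e => T (w e)) ∂(Measure.pi fun _ : E => μ.prod ν)) ^ 2 ≤
      ∫ w, f (fun e => (w e).1) * f (fun e => T' (w e)) ∂(Measure.pi fun _ : E => μ.prod ν') := by
  set α := Measure.pi fun _ : E => μ
  set β := Measure.pi fun _ : E => ν
  let S : (E → X) × (E → Z) → (E → X) := fun u e => T (u.1 e, u.2 e)
  have hS : Measurable S := by fun_prop
  -- `g` is the conditional expectation of the noisy value of `f` given `x`. The correlation is `∫ f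
  -- g`; two conditionally independent copies give `∫ g ^ 2`, which `h` identifies with the
  -- correlation for `T'`.
  set g : (E → X) → ℝ := fun x => ∫ z, f (S (x, z)) ∂β with hg
  have hgm : Measurable g :=
    (StronglyMeasurable.integral_prod_right (ν := β)
      (f := fun x z => f (S (x, z))) (hf.comp hS).stronglyMeasurable).measurable
  have hgb : ∀ x, |g x| ≤ 1 := fun x => by
    have := norm_integral_le_of_norm_le_const (μ := β) (f := fun z => f (S (x, z))) (C := 1)
      (Filter.Eventually.of_forall fun z => hb _)
    simpa using this
  have e1 : ∫ w, f (fun e => (w e).1) * f (fun e => T (w e)) ∂(Measure.pi fun _ : E => μ.prod ν)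
      = ∫ x, f x * g x ∂α := by
    rw [integral_pi_prod μ ν fun u => f u.1 * f (S u), integral_prod]
    · simp only [hg, integral_const_mul]; rfl
    · exact integrable_of_abs_le_one (by fun_prop) fun u => abs_mul_le_one (hb _) (hb _)
  have e2 : ∫ w, f (fun e => (w e).1) * f (fun e => T' (w e)) ∂(Measure.pi fun _ : E => μ.prod ν')
      = ∫ x, g x * g x ∂α := by
    have hF : Measurable fun u : E → X × X => f (fun e => (u e).1) * f (fun e => (u e).2) := by
      fun_prop
    rw [integral_pi_comp (μ.prod ν') (φ := fun w => (w.1, T' w)) (by fun_prop) hF, ← h,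
      ← integral_pi_comp (μ.prod (ν.prod ν)) (by fun_prop) hF]
    have := integral_pi_prod (E := E) μ (ν.prod ν) fun u =>
      f (fun e => T (u.1 e, (u.2 e).1)) * f (fun e => T (u.1 e, (u.2 e).2))
    rw [this, integral_prod]
    · refine integral_congr_ae (Filter.Eventually.of_forall fun x => ?_)
      have := integral_pi_prod (E := E) ν ν fun v => f (S (x, v.1)) * f (S (x, v.2))
      simp only
      exact this.trans (integral_prod_mul (fun z => f (S (x, z))) (fun z => f (S (x, z))))
    · exact integrable_of_abs_le_one (by fun_prop) fun u => abs_mul_le_one (hb _) (hb _)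
  rw [e1, e2]
  exact sq_integral_mul_le hf hgm hb hgb

end Pi

end EdwardsAnderson

/-! ### Correlations under resampling -/

namespace EdwardsAnderson

open scoped unitInterval

/-- A site of the second environment under resampling: `w = (J_e, (J'_e, ξ_e))`. -/
def resample (w : ℝ × (ℝ × Bool)) : ℝ := if w.2.2 = true then w.2.1 else w.1

theorem measurable_resample : Measurable resample := by
  unfold resample
  refine Measurable.ite ?_ (by fun_prop) (by fun_prop)
  exact (measurable_snd.snd) (measurableSet_singleton true)

theorem lintegral_bernoulliMeasure' (p : I) (g : Bool → ENNReal) :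
    ∫⁻ b, g b ∂(bernoulliMeasure true false p) =
      ENNReal.ofReal p * g true + ENNReal.ofReal (1 - p) * g false := by
  have h : ∀ r : I, ENNReal.ofReal r = unitInterval.toNNReal r := fun r => by
    rw [ENNReal.ofReal, Real.toNNReal_of_nonneg r.2.1]; rfl
  have h' : (1 - p : ℝ) = σ p := rfl
  rw [bernoulliMeasure_def, lintegral_add_measure, lintegral_smul_measure,
    lintegral_smul_measure, lintegral_dirac, lintegral_dirac, h', h, h]
  rfl

/-- Two copies both retain `x` with probability `q ^ 2`, and then coincide; in every other case they
form an independent pair. The right-hand side is the same mixture. The measure on `Bool` carries the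
replacement probability, hence `σ q`. -/
theorem resample_semigroup (q : I) (γ : Measure ℝ) [IsProbabilityMeasure γ] :
    (γ.prod ((γ.prod (bernoulliMeasure true false (σ q))).prod
      (γ.prod (bernoulliMeasure true false (σ q))))).map
        (fun w => (resample (w.1, w.2.1), resample (w.1, w.2.2))) =
      (γ.prod (γ.prod (bernoulliMeasure true false (σ (q ^ 2))))).map
        fun w => (w.1, resample w) := by
  have hm := measurable_resample
  refine Measure.ext_of_lintegral _ fun g hg => ?_
  rw [lintegral_map hg (by fun_prop), lintegral_map hg (by fun_prop)]
  rw [lintegral_prod _ (by fun_prop), lintegral_prod _ (by fun_prop)]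
  have e1 : ∀ x : ℝ, ∫⁻ z, g (x, resample (x, z))
        ∂(γ.prod (bernoulliMeasure true false (σ (q ^ 2)))) =
      ENNReal.ofReal (1 - q ^ 2) * ∫⁻ y, g (x, y) ∂γ + ENNReal.ofReal (q ^ 2) * g (x, x) := by
    intro x
    rw [lintegral_prod _ (by fun_prop)]
    simp only [lintegral_bernoulliMeasure']
    rw [lintegral_add_left (by fun_prop), lintegral_const_mul _ (by fun_prop)]
    simp [resample]
  have e2 : ∀ x : ℝ, ∫⁻ z, g (resample (x, z.1), resample (x, z.2))
        ∂((γ.prod (bernoulliMeasure true false (σ q))).prod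
          (γ.prod (bernoulliMeasure true false (σ q)))) =
      ENNReal.ofReal (1 - q) * (ENNReal.ofReal (1 - q) * ∫⁻ y, ∫⁻ y', g (y, y') ∂γ ∂γ +
        ENNReal.ofReal q * ∫⁻ y, g (y, x) ∂γ) +
      ENNReal.ofReal q * (ENNReal.ofReal (1 - q) * ∫⁻ y, g (x, y) ∂γ +
        ENNReal.ofReal q * g (x, x)) := by
    intro x
    have inner : ∀ a : ℝ, ∫⁻ z, g (a, resample (x, z))
        ∂(γ.prod (bernoulliMeasure true false (σ q))) =
      ENNReal.ofReal (1 - q) * ∫⁻ y, g (a, y) ∂γ + ENNReal.ofReal q * g (a, x) := by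
      intro a
      rw [lintegral_prod _ (by fun_prop)]
      simp only [lintegral_bernoulliMeasure']
      rw [lintegral_add_left (by fun_prop), lintegral_const_mul _ (by fun_prop)]
      simp [resample]
    have hmeas : Measurable fun y => ∫⁻ y', g (y, y') ∂γ := hg.lintegral_prod_right'
    rw [lintegral_prod _ (by fun_prop)]
    simp only [inner]
    rw [lintegral_prod _ (by fun_prop)]
    simp only [lintegral_bernoulliMeasure']
    rw [lintegral_add_left (by simp only [resample, if_true]; fun_prop),
      lintegral_const_mul _ (by simp only [resample, if_true]; fun_prop)]
    simp only [resample, if_true, Bool.false_eq_true, if_false, lintegral_const, measure_univ,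
      mul_one, unitInterval.coe_symm_eq, sub_sub_cancel]
    rw [lintegral_add_left (by fun_prop), lintegral_const_mul _ (by fun_prop),
      lintegral_const_mul _ (by fun_prop)]
  simp only [e1, e2]
  have hmeas : Measurable fun y => ∫⁻ y', g (y, y') ∂γ := hg.lintegral_prod_right'
  have hmeas' : Measurable fun y => ∫⁻ y', g (y', y) ∂γ := hg.lintegral_prod_left'
  have hq1 : (0 : ℝ) ≤ 1 - q := sub_nonneg.2 q.2.2
  have hq0 : (0 : ℝ) ≤ q := q.2.1
  rw [lintegral_add_left (by fun_prop), lintegral_const_mul _ (by fun_prop),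
    lintegral_add_left (by fun_prop), lintegral_const_mul _ (by fun_prop),
    lintegral_const_mul _ (by fun_prop), lintegral_add_left (by fun_prop),
    lintegral_const_mul _ (by fun_prop), lintegral_const_mul _ (by fun_prop),
    lintegral_add_left (by fun_prop),
    lintegral_const_mul _ (by fun_prop), lintegral_const_mul _ (by fun_prop)]
  rw [lintegral_lintegral_swap (μ := γ) (ν := γ) (f := fun x y => g (y, x)) (by fun_prop)]
  simp only [lintegral_const, measure_univ, mul_one]
  have h1 : (1 : ℝ) - q ^ 2 = (1 - q) * (1 - q) + ((1 - q) * q + q * (1 - q)) := by ring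
  rw [lintegral_const_mul _ (by fun_prop), h1, ENNReal.ofReal_add (by positivity) (by positivity),
    ENNReal.ofReal_add (by positivity) (by positivity), ENNReal.ofReal_mul hq1,
    ENNReal.ofReal_mul hq1, ENNReal.ofReal_mul hq0, pow_two, ENNReal.ofReal_mul hq0]
  ring

/-- `f` changes sign under a gauge transformation fixing any prescribed set of fewer than `m`
sites. -/
def IsFlippable {E : Type*} (m : ℕ) (f : (E → ℝ) → ℝ) : Prop :=
  ∀ A : Finset E, A.card < m → ∃ s : E → ℤˣ, (∀ e ∈ A, s e = 1) ∧
    ∀ x : E → ℝ, f (fun e => ((s e : ℤ) : ℝ) * x e) = -f x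

theorem measurePreserving_units_mul (s : ℤˣ) :
    MeasurePreserving (fun x : ℝ => ((s : ℤ) : ℝ) * x) (gaussianReal 0 1) (gaussianReal 0 1) := by
  refine ⟨by fun_prop, ?_⟩
  rw [gaussianReal_map_const_mul]
  rcases Int.units_eq_one_or s with rfl | rfl <;> simp

theorem integral_eq_zero_of_comp_eq_neg {Ω : Type*} [MeasurableSpace Ω] {P : Measure Ω}
    {R : Ω → Ω} (hR : MeasurePreserving R P P) {F : Ω → ℝ} (hF : Measurable F)
    (h : ∀ ω, F (R ω) = -F ω) : ∫ ω, F ω ∂P = 0 := by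
  have h1 : ∫ ω, F ω ∂P = ∫ ω, F (R ω) ∂P := by
    conv_lhs => rw [← hR.map_eq]
    exact integral_map hR.measurable.aemeasurable hF.aestronglyMeasurable
  simp only [h, integral_neg] at h1
  linarith

section

variable {E : Type*} [Fintype E]

/-- The correlation `E f(J) f(K)` under resampling with retention probability `q`. -/
def resampleCorrelation (f : (E → ℝ) → ℝ) (q : I) : ℝ :=
  ∫ w, f (fun e => (w e).1) * f (fun e => resample (w e)) ∂(Measure.pi fun _ : E =>
    (gaussianReal 0 1).prod ((gaussianReal 0 1).prod (bernoulliMeasure true false (σ q))))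

/-- The expectation is split according to the pattern `η` of replaced edges. A pattern retaining
fewer than `m` edges contributes zero by the sign symmetry; any other has probability at most `q ^
m`. The factor counts the patterns. -/
theorem resampleCorrelation_le_mul_pow {f : (E → ℝ) → ℝ} (hf : Measurable f)
    (hb : ∀ x, |f x| ≤ 1) {m : ℕ} (hm : IsFlippable m f) (q : I) :
    resampleCorrelation f q ≤ 2 ^ Fintype.card E * (q : ℝ) ^ m := by
  classical
  have hres := measurable_resample
  unfold resampleCorrelation
  set ν := (gaussianReal 0 1).prod
    ((gaussianReal 0 1).prod (bernoulliMeasure true false (σ q))) with hν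
  set P := Measure.pi fun _ : E => ν with hP
  let F : (E → ℝ × (ℝ × Bool)) → ℝ := fun w =>
    f (fun e => (w e).1) * f (fun e => resample (w e))
  have hF : Measurable F := by fun_prop
  have hFb : ∀ w, |F w| ≤ 1 := fun w => abs_mul_le_one (hb _) (hb _)
  let S : (E → Bool) → Set (E → ℝ × (ℝ × Bool)) := fun η =>
    Set.univ.pi fun e => Set.univ ×ˢ (Set.univ ×ˢ {η e})
  have hmemS : ∀ η w, w ∈ S η ↔ ∀ e, (w e).2.2 = η e := by
    intro η w; simp [S, Set.mem_pi]
  have hS : ∀ η, MeasurableSet (S η) := fun η => MeasurableSet.univ_pi fun e =>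
    MeasurableSet.univ.prod (MeasurableSet.univ.prod (measurableSet_singleton _))
  have hsum : ∀ w, F w = ∑ η, (S η).indicator F w := by
    intro w
    rw [Finset.sum_eq_single (fun e => (w e).2.2)]
    · rw [Set.indicator_of_mem ((hmemS _ _).2 fun e => rfl)]
    · intro η _ hη
      refine Set.indicator_of_notMem (fun h => hη ?_) _
      funext e
      exact ((hmemS _ _).1 h e).symm
    · simp
  have hFi : Integrable F P := integrable_of_abs_le_one hF.aestronglyMeasurable hFb
  have hterm : ∀ η : E → Bool, ∫ w, (S η).indicator F w ∂P ≤ (q : ℝ) ^ m := by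
    intro η
    set A : Finset E := Finset.univ.filter fun e => η e = false with hA
    rcases lt_or_ge A.card m with hlt | hge
    · obtain ⟨s, hs1, hs2⟩ := hm A hlt
      -- The signs act on the fresh variables only. As `s = 1` on the retained edges, this
      -- multiplies the whole perturbed environment by `s` and fixes the original one.
      have hR : MeasurePreserving (fun (w : E → ℝ × (ℝ × Bool)) e =>
          ((w e).1, (((s e : ℤ) : ℝ) * (w e).2.1, (w e).2.2))) P P :=
        measurePreserving_pi (f := fun e (v : ℝ × (ℝ × Bool)) =>
            (v.1, (((s e : ℤ) : ℝ) * v.2.1, v.2.2))) _ _ fun e =>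
          (MeasurePreserving.id _).prod
            ((measurePreserving_units_mul (s e)).prod (MeasurePreserving.id _))
      rw [integral_eq_zero_of_comp_eq_neg hR (hF.indicator (hS η))]
      · exact pow_nonneg q.2.1 _
      intro w
      have hiff : (fun e => ((w e).1, (((s e : ℤ) : ℝ) * (w e).2.1, (w e).2.2))) ∈ S η ↔ w ∈ S η := by
        rw [hmemS, hmemS]
      by_cases hw : w ∈ S η
      · rw [Set.indicator_of_mem (hiff.2 hw), Set.indicator_of_mem hw]
        simp only [F]
        rw [← mul_neg, ← hs2]
        congr 2
        funext e
        have hwe := (hmemS _ _).1 hw e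
        cases hη : η e with
        | true => simp [resample, hwe, hη]
        | false => simp [resample, hwe, hη, hs1 e (by simp [hA, hη])]
      · rw [Set.indicator_of_notMem (fun h => hw (hiff.1 h)), Set.indicator_of_notMem hw, neg_zero]
    · have h1 : ∫ w, (S η).indicator F w ∂P ≤ P.real (S η) := by
        rw [← integral_indicator_one (hS η)]
        refine integral_mono (hFi.indicator (hS η))
          ((integrable_const (1 : ℝ)).indicator (hS η)) fun w => ?_
        by_cases hw : w ∈ S η
        · simpa [hw] using (abs_le.1 (hFb w)).2
        · simp [hw]
      have h2 : P.real (S η) ≤ (q : ℝ) ^ A.card := by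
        simp only [measureReal_def, hP, S, Measure.pi_pi, ENNReal.toReal_prod]
        have : ∀ e ∈ Finset.univ,
            (ν (Set.univ ×ˢ (Set.univ ×ˢ {η e}))).toReal ≤ if η e = false then (q : ℝ) else 1 := by
          intro e _
          rw [hν, Measure.prod_prod, Measure.prod_prod]
          simp only [measure_univ, one_mul]
          split_ifs with h
          · rw [h, ← measureReal_def, bernoulliMeasure_real_apply_of_notMem_of_mem] <;> simp
          · rw [← measureReal_def]; exact measureReal_le_one
        refine (Finset.prod_le_prod (fun _ _ => ENNReal.toReal_nonneg) this).trans ?_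
        rw [← Finset.prod_filter, Finset.prod_const]
      exact h1.trans (h2.trans (pow_le_pow_of_le_one q.2.1 q.2.2 hge))
  calc ∫ w, F w ∂P = ∑ η, ∫ w, (S η).indicator F w ∂P := by
        simp_rw [hsum]
        exact integral_finsetSum _ fun η _ => hFi.indicator (hS η)
    _ ≤ ∑ _η : E → Bool, (q : ℝ) ^ m := Finset.sum_le_sum fun η _ => hterm η
    _ = _ := by simp

theorem resampleCorrelation_le {f : (E → ℝ) → ℝ} (hf : Measurable f)
    (hb : ∀ x, |f x| ≤ 1) {m : ℕ} (hm : IsFlippable m f) {q : I} (h0 : 0 < q) (h1 : q < 1) :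
    resampleCorrelation f q ≤ (q : ℝ) ^ m :=
  le_pow_of_sq_le_of_le_mul_pow one_pos
    (fun r _ _ => sq_correlation_le measurable_resample measurable_resample
      (resample_semigroup r _) hf hb)
    (fun r _ _ => resampleCorrelation_le_mul_pow hf hb hm r) h0 h1

end

end EdwardsAnderson

/-! ### Correlations under Gaussian perturbation -/

namespace EdwardsAnderson

open scoped unitInterval

/-- A site of the second environment under a Gaussian perturbation: `w = (J_e, J'_e)`. -/
def gaussianMix (ρ : ℝ) (w : ℝ × ℝ) : ℝ := ρ * w.1 + √(1 - ρ ^ 2) * w.2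

theorem measurable_gaussianMix (ρ : ℝ) : Measurable (gaussianMix ρ) := by
  unfold gaussianMix; fun_prop

theorem charFunDual_gaussianReal (L : StrongDual ℝ ℝ) :
    charFunDual (gaussianReal 0 1) L = Complex.exp (-((L 1 ^ 2 / 2 : ℝ) : ℂ)) := by
  rw [charFunDual_eq_charFun_map_one, gaussianReal_map_continuousLinearMap, charFun_gaussianReal]
  congr 1
  simp [max_eq_left (sq_nonneg (L 1))]

/-- Both sides are centred Gaussian with unit variances and covariance `ρ ^ 2`; the characteristic
functions agree. -/
theorem gaussianMix_semigroup {ρ : ℝ} (h0 : 0 ≤ ρ) (h1 : ρ ≤ 1) :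
    ((gaussianReal 0 1).prod ((gaussianReal 0 1).prod (gaussianReal 0 1))).map
        (fun w => (gaussianMix ρ (w.1, w.2.1), gaussianMix ρ (w.1, w.2.2))) =
      ((gaussianReal 0 1).prod (gaussianReal 0 1)).map fun w => (w.1, gaussianMix (ρ ^ 2) w) := by
  let T1 : ℝ × (ℝ × ℝ) →L[ℝ] ℝ × ℝ :=
    (ρ • ContinuousLinearMap.fst ℝ ℝ (ℝ × ℝ) + √(1 - ρ ^ 2) •
      (ContinuousLinearMap.fst ℝ ℝ ℝ).comp (ContinuousLinearMap.snd ℝ ℝ (ℝ × ℝ))).prod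
    (ρ • ContinuousLinearMap.fst ℝ ℝ (ℝ × ℝ) + √(1 - ρ ^ 2) •
      (ContinuousLinearMap.snd ℝ ℝ ℝ).comp (ContinuousLinearMap.snd ℝ ℝ (ℝ × ℝ)))
  let T2 : ℝ × ℝ →L[ℝ] ℝ × ℝ := (ContinuousLinearMap.fst ℝ ℝ ℝ).prod
    (ρ ^ 2 • ContinuousLinearMap.fst ℝ ℝ ℝ +
      √(1 - (ρ ^ 2) ^ 2) • ContinuousLinearMap.snd ℝ ℝ ℝ)
  have e1 : (fun w : ℝ × (ℝ × ℝ) => (gaussianMix ρ (w.1, w.2.1), gaussianMix ρ (w.1, w.2.2))) =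
      T1 := by
    ext w <;> simp [T1, gaussianMix]
  have e2 : (fun w : ℝ × ℝ => (w.1, gaussianMix (ρ ^ 2) w)) = T2 := by
    ext w <;> simp [T2, gaussianMix]
  rw [e1, e2]
  have := Measure.isProbabilityMeasure_map (f := T1) (μ := (gaussianReal 0 1).prod
    ((gaussianReal 0 1).prod (gaussianReal 0 1))) T1.continuous.measurable.aemeasurable
  have := Measure.isProbabilityMeasure_map (f := T2) (μ := (gaussianReal 0 1).prod
    (gaussianReal 0 1)) T2.continuous.measurable.aemeasurable
  refine Measure.ext_of_charFunDual (funext fun L => ?_)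
  rw [charFunDual_map, charFunDual_map, charFunDual_prod, charFunDual_prod, charFunDual_prod,
    charFunDual_gaussianReal, charFunDual_gaussianReal, charFunDual_gaussianReal,
    charFunDual_gaussianReal, charFunDual_gaussianReal, ← Complex.exp_add, ← Complex.exp_add,
    ← Complex.exp_add]
  congr 1
  norm_cast
  obtain ⟨a, b, hL⟩ : ∃ a b : ℝ, ∀ u v : ℝ, L (u, v) = u * a + v * b := by
    refine ⟨L (1, 0), L (0, 1), fun u v => ?_⟩
    have : ((u, v) : ℝ × ℝ) = u • (1, 0) + v • (0, 1) := by simp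
    rw [this, map_add, map_smul, map_smul, smul_eq_mul, smul_eq_mul]
  have s1 : √(1 - ρ ^ 2) ^ 2 = 1 - ρ ^ 2 := Real.sq_sqrt (by nlinarith)
  have s2 : √(1 - (ρ ^ 2) ^ 2) ^ 2 = 1 - (ρ ^ 2) ^ 2 :=
    Real.sq_sqrt (by nlinarith [mul_nonneg h0 h0, pow_le_one₀ (n := 4) h0 h1])
  simp only [ContinuousLinearMap.comp_apply, T1, T2, ContinuousLinearMap.inl_apply,
    ContinuousLinearMap.inr_apply, ContinuousLinearMap.prod_apply, add_apply,
    smul_apply, ContinuousLinearMap.coe_fst', ContinuousLinearMap.coe_snd',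
    smul_eq_mul, mul_one, mul_zero, add_zero, zero_add, Prod.fst_zero, Prod.snd_zero, hL]
  linear_combination (-(a ^ 2 + b ^ 2) / 2) * s1 + b ^ 2 / 2 * s2

/-- The density of the law of `(x, gaussianMix ρ (x, z))` with respect to the product Gaussian. -/
def mehler (ρ : ℝ) (w : ℝ × ℝ) : ℝ :=
  (√(1 - ρ ^ 2))⁻¹ *
    Real.exp ((2 * ρ * w.1 * w.2 - ρ ^ 2 * (w.1 ^ 2 + w.2 ^ 2)) / (2 * (1 - ρ ^ 2)))

theorem measurable_mehler (ρ : ℝ) : Measurable (mehler ρ) := by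
  unfold mehler; fun_prop

theorem mehler_nonneg (ρ : ℝ) (w : ℝ × ℝ) : 0 ≤ mehler ρ w := by
  unfold mehler; positivity

theorem gaussianPDFReal_mul_mehler {ρ : ℝ} (hρ : 0 < 1 - ρ ^ 2) (x y : ℝ) :
    gaussianPDFReal 0 1 y * mehler ρ (x, y) =
      gaussianPDFReal (ρ * x) (1 - ρ ^ 2).toNNReal y := by
  simp only [gaussianPDFReal, mehler, Real.coe_toNNReal _ hρ.le, NNReal.coe_one, mul_one, sub_zero]
  rw [Real.sqrt_mul (show 0 ≤ 2 * Real.pi by positivity), mul_inv, mul_mul_mul_comm, ← Real.exp_add]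
  congr 2
  field_simp
  ring

/-- Given `x`, the second coordinate has law `N(ρ x, 1 - ρ ^ 2)`, and `mehler` is the ratio of its
density to the standard one. -/
theorem map_gaussianMix_eq_withDensity {ρ : ℝ} (hρ : 0 < 1 - ρ ^ 2) :
    ((gaussianReal 0 1).prod (gaussianReal 0 1)).map (fun w => (w.1, gaussianMix ρ w)) =
      ((gaussianReal 0 1).prod (gaussianReal 0 1)).withDensity
        fun w => ENNReal.ofReal (mehler ρ w) := by
  have hm := measurable_gaussianMix ρ
  have hM := measurable_mehler ρ
  have hv : (1 - ρ ^ 2).toNNReal ≠ 0 := by simpa using hρ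
  refine Measure.ext_of_lintegral _ fun g hg => ?_
  rw [lintegral_map hg (by fun_prop), lintegral_withDensity_eq_lintegral_mul _ (by fun_prop) hg,
    lintegral_prod _ (by fun_prop), lintegral_prod _ (by fun_prop)]
  refine lintegral_congr fun x => ?_
  have hmap : (gaussianReal 0 1).map (fun z => gaussianMix ρ (x, z)) =
      gaussianReal (ρ * x) (1 - ρ ^ 2).toNNReal := by
    have : (fun z => gaussianMix ρ (x, z)) = (fun z => ρ * x + z) ∘ fun z => √(1 - ρ ^ 2) * z := rfl
    rw [this, ← Measure.map_map (by fun_prop) (by fun_prop), gaussianReal_map_const_mul,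
      gaussianReal_map_const_add]
    congr 1
    · simp
    · ext; simp [Real.sq_sqrt hρ.le, hρ.le]
  have e1 : ∫⁻ z, g (x, gaussianMix ρ (x, z)) ∂(gaussianReal 0 1) =
      ∫⁻ y, g (x, y) ∂(gaussianReal (ρ * x) (1 - ρ ^ 2).toNNReal) := by
    rw [← hmap, lintegral_map (by fun_prop) (by fun_prop)]
  rw [e1, gaussianReal_of_var_ne_zero _ hv, gaussianReal_of_var_ne_zero _ one_ne_zero,
    lintegral_withDensity_eq_lintegral_mul _ (measurable_gaussianPDF _ _) (by fun_prop),
    lintegral_withDensity_eq_lintegral_mul _ (measurable_gaussianPDF _ _) (by fun_prop)]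
  refine lintegral_congr fun y => ?_
  simp only [Pi.mul_apply, gaussianPDF]
  rw [← mul_assoc, ← ENNReal.ofReal_mul (gaussianPDFReal_nonneg _ _ _),
    gaussianPDFReal_mul_mehler hρ]

theorem abs_exp_sub_one_le_mul_exp_abs (t : ℝ) : |Real.exp t - 1| ≤ |t| * Real.exp |t| := by
  rcases le_total 0 t with h | h
  · rw [abs_of_nonneg h, abs_of_nonneg (by linarith [Real.one_le_exp h])]
    have h1 : 1 - t ≤ Real.exp (-t) := by linarith [Real.add_one_le_exp (-t)]
    have h2 := mul_le_mul_of_nonneg_right h1 (Real.exp_pos t).le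
    rw [← Real.exp_add] at h2
    simp at h2
    linarith
  · rw [abs_of_nonpos h, abs_of_nonpos (by linarith [Real.exp_le_one_iff.2 h])]
    have h1 := Real.add_one_le_exp t
    have h2 : 1 ≤ Real.exp (-t) := Real.one_le_exp (by linarith)
    nlinarith

/-- The kernel is `exp t` with `|t| ≤ ρ u`, `u = 1 + x ^ 2 + y ^ 2`. For `ρ ≤ 1 / 8`, both `exp |t|`
and `u / 8` are at most `exp (u / 8)`, so the bound grows like `exp (u / 4)`, which is still
integrable against the Gaussian. -/
theorem abs_mehler_sub_one_le {ρ : ℝ} (h0 : 0 ≤ ρ) (h1 : ρ ≤ 1 / 8) (w : ℝ × ℝ) :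
    |mehler ρ w - 1| ≤
      8 * Real.exp (1 / 4) * ρ * (Real.exp (w.1 ^ 2 / 4) * Real.exp (w.2 ^ 2 / 4)) := by
  obtain ⟨x, y⟩ := w
  have hv : 0 < 1 - ρ ^ 2 := by nlinarith
  have hv' : 3 / 4 ≤ 1 - ρ ^ 2 := by nlinarith
  set u := 1 + x ^ 2 + y ^ 2 with hu
  set t := -(Real.log (1 - ρ ^ 2) / 2) +
    (2 * ρ * x * y - ρ ^ 2 * (x ^ 2 + y ^ 2)) / (2 * (1 - ρ ^ 2)) with ht
  have hM : mehler ρ (x, y) = Real.exp t := by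
    rw [ht, Real.exp_add, Real.exp_neg, ← Real.log_sqrt hv.le, Real.exp_log (Real.sqrt_pos.2 hv)]
    rfl
  have habs : |t| ≤ ρ * u := by
    have l1 : Real.log (1 - ρ ^ 2) ≤ 0 := Real.log_nonpos hv.le (by nlinarith)
    have l2 : -Real.log (1 - ρ ^ 2) ≤ ρ := by
      have := Real.one_sub_inv_le_log_of_pos hv
      have h3 : (1 - ρ ^ 2)⁻¹ ≤ 1 + ρ := by
        rw [inv_le_iff_one_le_mul₀ hv]; nlinarith
      linarith
    have l3 : |2 * ρ * x * y - ρ ^ 2 * (x ^ 2 + y ^ 2)| ≤ (ρ + ρ ^ 2) * (x ^ 2 + y ^ 2) := by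
      rw [abs_le]
      constructor <;> nlinarith [mul_nonneg h0 (sq_nonneg (x - y)), mul_nonneg h0 (sq_nonneg (x + y)),
        mul_nonneg (sq_nonneg ρ) (add_nonneg (sq_nonneg x) (sq_nonneg y))]
    have l4 : |(2 * ρ * x * y - ρ ^ 2 * (x ^ 2 + y ^ 2)) / (2 * (1 - ρ ^ 2))| ≤
        ρ * (x ^ 2 + y ^ 2) := by
      rw [abs_div, abs_of_pos (by linarith : 0 < 2 * (1 - ρ ^ 2)), div_le_iff₀ (by linarith)]
      refine l3.trans ?_
      have : ρ + ρ ^ 2 ≤ ρ * (2 * (1 - ρ ^ 2)) := by nlinarith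
      nlinarith [add_nonneg (sq_nonneg x) (sq_nonneg y)]
    calc |t| ≤ |-(Real.log (1 - ρ ^ 2) / 2)| + _ := abs_add_le _ _
      _ ≤ ρ + ρ * (x ^ 2 + y ^ 2) := by
        refine add_le_add ?_ l4
        rw [abs_of_nonneg (by linarith)]; linarith
      _ = ρ * u := by rw [hu]; ring
  have hu0 : 0 ≤ u := by positivity
  have h8 : u ≤ 8 * Real.exp (u / 8) := by linarith [Real.add_one_le_exp (u / 8)]
  calc |mehler ρ (x, y) - 1| = |Real.exp t - 1| := by rw [hM]
    _ ≤ |t| * Real.exp |t| := abs_exp_sub_one_le_mul_exp_abs t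
    _ ≤ (ρ * (8 * Real.exp (u / 8))) * Real.exp (u / 8) := by
        refine mul_le_mul (habs.trans (by gcongr)) (Real.exp_le_exp.2 (habs.trans ?_))
          (Real.exp_pos _).le (by positivity)
        nlinarith
    _ = 8 * ρ * Real.exp (u / 4) := by
        rw [show u / 4 = u / 8 + u / 8 by ring, Real.exp_add]; ring
    _ = _ := by
        rw [show u / 4 = 1 / 4 + (x ^ 2 / 4 + y ^ 2 / 4) by rw [hu]; ring, Real.exp_add,
          Real.exp_add]
        ring

theorem integrable_exp_sq_div_four :
    Integrable (fun x : ℝ => Real.exp (x ^ 2 / 4)) (gaussianReal 0 1) := by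
  rw [gaussianReal_of_var_ne_zero _ one_ne_zero,
    integrable_withDensity_iff (measurable_gaussianPDF _ _)
      (Filter.Eventually.of_forall fun _ => gaussianPDF_lt_top)]
  refine ((integrable_exp_neg_mul_sq (b := 1 / 4) (by norm_num)).const_mul
    (√(2 * Real.pi))⁻¹).congr (Filter.Eventually.of_forall fun x => ?_)
  simp only [toReal_gaussianPDF, gaussianPDFReal, NNReal.coe_one, mul_one, sub_zero]
  rw [mul_left_comm, ← Real.exp_add]
  congr 2
  ring

/-- The `L¹` distance of the law of two `ρ`-correlated Gaussians from the product law is `O(ρ)`. -/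
theorem exists_integral_abs_mehler_sub_one_le : ∃ c : ℝ, 0 ≤ c ∧ ∀ ρ : ℝ, 0 ≤ ρ → ρ ≤ 1 / 8 →
    Integrable (fun w => mehler ρ w - 1) ((gaussianReal 0 1).prod (gaussianReal 0 1)) ∧
    ∫ w, |mehler ρ w - 1| ∂((gaussianReal 0 1).prod (gaussianReal 0 1)) ≤ c * ρ := by
  refine ⟨8 * Real.exp (1 / 4) * ∫ w : ℝ × ℝ, Real.exp (w.1 ^ 2 / 4) * Real.exp (w.2 ^ 2 / 4)
    ∂((gaussianReal 0 1).prod (gaussianReal 0 1)), by positivity, fun ρ h0 h1 => ?_⟩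
  have hi := (integrable_exp_sq_div_four.mul_prod integrable_exp_sq_div_four).const_mul
    (8 * Real.exp (1 / 4) * ρ)
  have hint : Integrable (fun w => mehler ρ w - 1)
      ((gaussianReal 0 1).prod (gaussianReal 0 1)) :=
    hi.mono' ((measurable_mehler ρ).sub_const 1).aestronglyMeasurable
      (Filter.Eventually.of_forall fun w => abs_mehler_sub_one_le h0 h1 w)
  refine ⟨hint, (integral_mono hint.abs hi fun w => abs_mehler_sub_one_le h0 h1 w).trans ?_⟩
  rw [integral_const_mul]
  exact le_of_eq (by ring)

section

variable {E : Type*} [Fintype E]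

theorem pi_withDensity_ofReal {X : Type*} [MeasurableSpace X] (μ : Measure X)
    [SigmaFinite μ] {g : X → ℝ} (hg : Integrable g μ) (h0 : ∀ x, 0 ≤ g x) :
    (Measure.pi fun _ : E => μ.withDensity fun x => ENNReal.ofReal (g x)) =
      (Measure.pi fun _ : E => μ).withDensity fun u => ENNReal.ofReal (∏ e, g (u e)) := by
  have hfin : IsFiniteMeasure (μ.withDensity fun x => ENNReal.ofReal (g x)) :=
    isFiniteMeasure_withDensity_ofReal hg.2
  have hgi : Integrable (fun u : E → X => ∏ e, g (u e)) (Measure.pi fun _ : E => μ) :=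
    Integrable.fintype_prod fun _ => hg
  refine Measure.pi_eq fun s hs => ?_
  have hS : MeasurableSet (Set.univ.pi s) := MeasurableSet.univ_pi hs
  have key : ∀ e, (μ.withDensity fun x => ENNReal.ofReal (g x)) (s e) =
      ENNReal.ofReal (∫ x, (s e).indicator g x ∂μ) := by
    intro e
    rw [withDensity_apply _ (hs e), integral_indicator (hs e),
      ofReal_integral_eq_lintegral_ofReal hg.integrableOn (Filter.Eventually.of_forall h0)]
  simp_rw [key]
  rw [withDensity_apply _ hS, ← ENNReal.ofReal_prod_of_nonneg
      fun e _ => integral_nonneg fun x => Set.indicator_nonneg (fun x _ => h0 x) x,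
    ← integral_fintype_prod_eq_prod, ← ofReal_integral_eq_lintegral_ofReal hgi.integrableOn
      (Filter.Eventually.of_forall fun u => Finset.prod_nonneg fun e _ => h0 _),
    ← integral_indicator hS]
  congr 2
  funext u
  by_cases hu : u ∈ Set.univ.pi s
  · rw [Set.indicator_of_mem hu]
    exact Finset.prod_congr rfl fun e _ => (Set.indicator_of_mem (hu e trivial) _).symm
  · rw [Set.indicator_of_notMem hu]
    simp only [Set.mem_pi, Set.mem_univ, true_implies, not_forall] at hu
    obtain ⟨e, he⟩ := hu
    exact (Finset.prod_eq_zero (Finset.mem_univ e) (Set.indicator_of_notMem he _)).symm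

/-- The correlation `E f(J) f(K)` when `K` is a Gaussian perturbation with covariance `q`. -/
def gaussianCorrelation (f : (E → ℝ) → ℝ) (q : I) : ℝ :=
  ∫ w, f (fun e => (w e).1) * f (fun e => gaussianMix q (w e))
    ∂(Measure.pi fun _ : E => (gaussianReal 0 1).prod (gaussianReal 0 1))

/-- In the expansion of `∏ (1 + (mehler - 1))` over sets `A`, the second environment enters the
`A`-weight only through edges of `A`. Flipping signs off `A` therefore kills the terms with fewer
than `m` edges, and the others are at most `(c q) ^ |A|` by the `L¹` estimate. -/
theorem exists_gaussianCorrelation_le_mul_pow {f : (E → ℝ) → ℝ} (hf : Measurable f)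
    (hb : ∀ x, |f x| ≤ 1) {m : ℕ} (hm : IsFlippable m f) :
    ∃ C : ℝ, ∀ q : I, (q : ℝ) < 1 / 8 → gaussianCorrelation f q ≤ C * (q : ℝ) ^ m := by
  classical
  obtain ⟨c, hc, hmehler⟩ := exists_integral_abs_mehler_sub_one_le
  refine ⟨∑ A : Finset E, c ^ A.card, fun q hq => ?_⟩
  have hq0 : (0 : ℝ) ≤ q := q.2.1
  have hv : 0 < 1 - (q : ℝ) ^ 2 := by nlinarith
  obtain ⟨hNi, hN⟩ := hmehler q hq0 hq.le
  set γ := (gaussianReal 0 1).prod (gaussianReal 0 1) with hγ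
  set P := Measure.pi fun _ : E => γ with hP
  let F : (E → ℝ × ℝ) → ℝ := fun u => f (fun e => (u e).1) * f (fun e => (u e).2)
  have hF : Measurable F := by fun_prop
  have hFb : ∀ u, |F u| ≤ 1 := fun u => abs_mul_le_one (hb _) (hb _)
  have hMi : Integrable (mehler q) γ :=
    (hNi.add (integrable_const (1 : ℝ))).congr (Filter.Eventually.of_forall fun w => by simp)
  have hMm := measurable_mehler q
  have hpow : ∀ A : Finset E, Integrable
      (fun u : E → ℝ × ℝ => ∏ e, if e ∈ A then |mehler q (u e) - 1| else 1) P := by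
    intro A
    refine Integrable.fintype_prod (μ := fun _ => γ)
      (f := fun e v => if e ∈ A then |mehler q v - 1| else 1) fun e => ?_
    by_cases he : e ∈ A
    · simpa [he] using hNi.abs
    · simp [he]
  have hbound : ∀ (A : Finset E) (u : E → ℝ × ℝ), ‖(∏ e ∈ A, (mehler q (u e) - 1)) * F u‖ ≤
      ∏ e, if e ∈ A then |mehler q (u e) - 1| else 1 := by
    intro A u
    rw [Finset.prod_ite_mem, Finset.univ_inter, norm_mul, Real.norm_eq_abs, Real.norm_eq_abs,
      Finset.abs_prod]
    exact mul_le_of_le_one_right (Finset.prod_nonneg fun _ _ => abs_nonneg _) (hFb u)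
  have hmeas : ∀ A : Finset E, Measurable
      fun u : E → ℝ × ℝ => (∏ e ∈ A, (mehler q (u e) - 1)) * F u := fun A =>
    (Finset.measurable_fun_prod A fun e _ => by fun_prop).mul hF
  have hint : ∀ A : Finset E, Integrable
      (fun u : E → ℝ × ℝ => (∏ e ∈ A, (mehler q (u e) - 1)) * F u) P := fun A =>
    (hpow A).mono' (hmeas A).aestronglyMeasurable (Filter.Eventually.of_forall (hbound A))
  have hterm : ∀ A : Finset E, ∫ u, (∏ e ∈ A, (mehler q (u e) - 1)) * F u ∂P ≤
      c ^ A.card * (q : ℝ) ^ m := by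
    intro A
    rcases lt_or_ge A.card m with hlt | hge
    · obtain ⟨s, hs1, hs2⟩ := hm A hlt
      -- Only the second environment is flipped; the factors indexed by `A` are unchanged because `s
      -- = 1` there.
      have hR : MeasurePreserving (fun (u : E → ℝ × ℝ) e => ((u e).1, ((s e : ℤ) : ℝ) * (u e).2))
          P P :=
        measurePreserving_pi (f := fun e (v : ℝ × ℝ) => (v.1, ((s e : ℤ) : ℝ) * v.2)) _ _ fun e =>
          (MeasurePreserving.id _).prod (measurePreserving_units_mul (s e))
      rw [integral_eq_zero_of_comp_eq_neg hR (hmeas A)]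
      · positivity
      intro u
      rw [← mul_neg]
      congr 1
      · exact Finset.prod_congr rfl fun e he => by simp [hs1 e he]
      · simp only [F]
        rw [← mul_neg, ← hs2]
    · calc ∫ u, (∏ e ∈ A, (mehler q (u e) - 1)) * F u ∂P
          ≤ ∫ u, (∏ e, if e ∈ A then |mehler q (u e) - 1| else 1) ∂P :=
            integral_mono (hint A) (hpow A) fun u => (le_abs_self _).trans (hbound A u)
        _ = ∏ e : E, if e ∈ A then ∫ v, |mehler q v - 1| ∂γ else 1 := by
            rw [integral_fintype_prod_eq_prod (μ := fun _ => γ)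
              (f := fun e v => if e ∈ A then |mehler q v - 1| else 1)]
            refine Finset.prod_congr rfl fun e _ => ?_
            by_cases he : e ∈ A <;> simp [he]
        _ = (∫ v, |mehler q v - 1| ∂γ) ^ A.card := by
            rw [Finset.prod_ite_mem, Finset.univ_inter, Finset.prod_const]
        _ ≤ (c * q) ^ A.card :=
            pow_le_pow_left₀ (integral_nonneg fun _ => abs_nonneg _) hN _
        _ ≤ c ^ A.card * (q : ℝ) ^ m := by
            rw [mul_pow]
            exact mul_le_mul_of_nonneg_left (pow_le_pow_of_le_one hq0 q.2.2 hge) (by positivity)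
  have hgm := measurable_gaussianMix q
  calc gaussianCorrelation f q
      = ∫ u, F u ∂(Measure.pi fun _ : E => γ.map fun w => (w.1, gaussianMix q w)) :=
        integral_pi_comp γ (φ := fun w => (w.1, gaussianMix q w)) (by fun_prop) hF
    _ = ∫ u, (∏ e, mehler q (u e)) * F u ∂P := by
        rw [hγ, map_gaussianMix_eq_withDensity hv, pi_withDensity_ofReal γ hMi (mehler_nonneg q),
          integral_withDensity_eq_integral_toReal_smul (by fun_prop)
            (Filter.Eventually.of_forall fun _ => ENNReal.ofReal_lt_top)]
        refine integral_congr_ae (Filter.Eventually.of_forall fun u => ?_)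
        simp only [smul_eq_mul]
        rw [ENNReal.toReal_ofReal (Finset.prod_nonneg fun e _ => mehler_nonneg q _)]
    _ = ∫ u, ∑ A : Finset E, (∏ e ∈ A, (mehler q (u e) - 1)) * F u ∂P := by
        refine integral_congr_ae (Filter.Eventually.of_forall fun u => ?_)
        simp only
        rw [← Finset.sum_mul, ← Finset.powerset_univ, ← Finset.prod_add_one]
        simp
    _ = ∑ A : Finset E, ∫ u, (∏ e ∈ A, (mehler q (u e) - 1)) * F u ∂P :=
        integral_finsetSum _ fun A _ => hint A
    _ ≤ ∑ A : Finset E, c ^ A.card * (q : ℝ) ^ m := Finset.sum_le_sum fun A _ => hterm A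
    _ = _ := by rw [Finset.sum_mul]

theorem gaussianCorrelation_le {f : (E → ℝ) → ℝ} (hf : Measurable f)
    (hb : ∀ x, |f x| ≤ 1) {m : ℕ} (hm : IsFlippable m f) {q : I} (h0 : 0 < q) (h1 : q < 1) :
    gaussianCorrelation f q ≤ (q : ℝ) ^ m := by
  obtain ⟨C, hC⟩ := exists_gaussianCorrelation_le_mul_pow hf hb hm
  exact le_pow_of_sq_le_of_le_mul_pow (by norm_num : (0 : ℝ) < 1 / 8)
    (fun r _ _ => sq_correlation_le (measurable_gaussianMix r) (measurable_gaussianMix _)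
      (by simpa using gaussianMix_semigroup r.2.1 r.2.2) hf hb)
    (fun r _ hr => hC r hr) h0 h1

end

end EdwardsAnderson

/-! ### Common consequences of the two perturbations -/

namespace EdwardsAnderson

section Perturbation

open scoped unitInterval

/-- `(J, K)` is a pair of environments with the standard Gaussian marginals such that functions
flippable at order `m` have correlation at most `q ^ m`. -/
structure IsDecorrelated {Ω : Type*} [MeasurableSpace Ω] (P : Measure Ω) {E : Type*} [Fintype E]
    (q : ℝ) (J K : Ω → E → ℝ) : Prop where
  law_left : HasLaw J (Measure.pi fun _ : E => gaussianReal 0 1) P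
  law_right : HasLaw K (Measure.pi fun _ : E => gaussianReal 0 1) P
  correlation_le : ∀ (f : (E → ℝ) → ℝ) (m : ℕ), Measurable f → (∀ x, |f x| ≤ 1) →
    IsFlippable m f → ∫ ω, f (J ω) * f (K ω) ∂P ≤ q ^ m

variable {X Z Z' : Type*} [MeasurableSpace X] [MeasurableSpace Z] [MeasurableSpace Z']

/-- Compare the first marginals of `h`. This yields that the perturbed environment is again standard
Gaussian. -/
theorem map_eq_of_semigroup {μ : Measure X} {ν : Measure Z} {ν' : Measure Z'}
    [IsProbabilityMeasure μ] [IsProbabilityMeasure ν] [IsProbabilityMeasure ν']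
    {T : X × Z → X} {T' : X × Z' → X} (hT : Measurable T) (hT' : Measurable T')
    (h : (μ.prod (ν.prod ν)).map (fun w => (T (w.1, w.2.1), T (w.1, w.2.2))) =
      (μ.prod ν').map fun w => (w.1, T' w)) : (μ.prod ν).map T = μ := by
  have h1 := congrArg (Measure.map Prod.fst) h
  rw [Measure.map_map measurable_fst (by fun_prop), Measure.map_map measurable_fst (by fun_prop)]
    at h1
  have h2 : MeasurePreserving (fun w : X × (Z × Z) => (w.1, w.2.1)) (μ.prod (ν.prod ν))
      (μ.prod ν) := (MeasurePreserving.id μ).prod measurePreserving_fst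
  rw [← h2.map_eq, Measure.map_map hT h2.measurable]
  refine Eq.trans h1 ?_
  exact (measurePreserving_fst (μ := μ) (ν := ν')).map_eq

theorem isDecorrelated_of_hasLaw {Ω : Type*} [MeasurableSpace Ω] {P : Measure Ω} {E : Type*}
    [Fintype E] {q : ℝ} {J K : Ω → E → ℝ} {W : Ω → E → ℝ × Z} {ν : Measure Z}
    [IsProbabilityMeasure ν] {T : ℝ × Z → ℝ} (hT : Measurable T)
    (hW : HasLaw W (Measure.pi fun _ : E => (gaussianReal 0 1).prod ν) P)
    (hJ : ∀ ω e, J ω e = (W ω e).1) (hK : ∀ ω e, K ω e = T (W ω e))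
    (hmap : ((gaussianReal 0 1).prod ν).map T = gaussianReal 0 1)
    (hcorr : ∀ (f : (E → ℝ) → ℝ) (m : ℕ), Measurable f → (∀ x, |f x| ≤ 1) → IsFlippable m f →
      ∫ w, f (fun e => (w e).1) * f (fun e => T (w e))
        ∂(Measure.pi fun _ : E => (gaussianReal 0 1).prod ν) ≤ q ^ m) :
    IsDecorrelated P q J K := by
  have eJ : J = (fun w e => (w e).1) ∘ W := by ext ω e; exact hJ ω e
  have eK : K = (fun w e => T (w e)) ∘ W := by ext ω e; exact hK ω e
  refine ⟨?_, ?_, fun f m hf hb hm => ?_⟩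
  · rw [eJ]
    exact (measurePreserving_pi _ _ fun _ => measurePreserving_fst).hasLaw.comp hW
  · rw [eK]
    exact (measurePreserving_pi (f := fun _ => T) _ _ fun _ => ⟨hT, hmap⟩).hasLaw.comp hW
  · refine le_trans (le_of_eq ?_) (hcorr f m hf hb hm)
    rw [← hW.map_eq, integral_map hW.aemeasurable
      (Measurable.aestronglyMeasurable (by fun_prop)), eJ, eK]
    rfl

theorem isDecorrelated {Ω : Type*} [MeasurableSpace Ω] {P : Measure Ω} {E : Type*} [Fintype E]
    {p : I} (h0 : 0 < p) (h1 : p < 1) {J K : Ω → E → ℝ}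
    (h : IsGaussianPerturbation P p J K ∨ IsResamplingPerturbation P p J K) :
    IsDecorrelated P (1 - p) J K := by
  have h0' : 0 < σ p := by
    rw [← unitInterval.coe_pos, unitInterval.coe_symm_eq]
    exact sub_pos.2 (by exact_mod_cast h1)
  have h1' : σ p < 1 := by
    rw [← unitInterval.coe_lt_one, unitInterval.coe_symm_eq]
    exact sub_lt_self _ (by exact_mod_cast h0)
  rcases h with ⟨J', hW, hK⟩ | ⟨J', ξ, hW, hK⟩
  · refine isDecorrelated_of_hasLaw (measurable_gaussianMix (σ p)) hW (fun _ _ => rfl)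
      (fun ω e => ?_) (map_eq_of_semigroup (measurable_gaussianMix _) (measurable_gaussianMix _)
        (gaussianMix_semigroup (σ p).2.1 (σ p).2.2))
      (fun f m hf hb hm => gaussianCorrelation_le hf hb hm h0' h1')
    -- The coefficients match since `1 - (1 - p) ^ 2 = 2 p - p ^ 2`.
    rw [hK, gaussianMix, unitInterval.coe_symm_eq]
    ring_nf
  · refine isDecorrelated_of_hasLaw measurable_resample hW (fun _ _ => rfl)
      (fun ω e => hK ω e) ?_ (fun f m hf hb hm => ?_)
    · have := map_eq_of_semigroup measurable_resample measurable_resample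
        (resample_semigroup (σ p) (gaussianReal 0 1))
      rwa [unitInterval.symm_symm] at this
    · have := resampleCorrelation_le hf hb hm h0' h1'
      rwa [resampleCorrelation, unitInterval.symm_symm, unitInterval.coe_symm_eq] at this

theorem pi_gaussianReal_absolutelyContinuous (E : Type*) [Fintype E] :
    (Measure.pi fun _ : E => gaussianReal 0 1) ≪ (volume : Measure (E → ℝ)) := by
  have h := pi_withDensity_ofReal (E := E) (volume : Measure ℝ) (integrable_gaussianPDFReal 0 1)
    (gaussianPDFReal_nonneg 0 1)
  rw [gaussianReal_of_var_ne_zero _ one_ne_zero]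
  exact h ▸ withDensity_absolutelyContinuous _ _

/-- The kernel of a nonzero linear form is a proper subspace, hence Lebesgue-null, hence
Gaussian-null. -/
theorem ae_sum_mul_ne_zero {E : Type*} [Fintype E] {c : E → ℝ} (hc : c ≠ 0) :
    ∀ᵐ x ∂(Measure.pi fun _ : E => gaussianReal 0 1), ∑ e, x e * c e ≠ 0 := by
  classical
  suffices h : ∀ᵐ x ∂(volume : Measure (E → ℝ)), ∑ e, x e * c e ≠ 0 from
    (pi_gaussianReal_absolutelyContinuous E).ae_le h
  let ℓ : (E → ℝ) →ₗ[ℝ] ℝ := ∑ e, c e • LinearMap.proj e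
  have hℓ : ∀ x, ℓ x = ∑ e, x e * c e := fun x => by simp [ℓ, mul_comm]
  have htop : LinearMap.ker ℓ ≠ ⊤ := by
    intro h
    refine hc (funext fun e => ?_)
    have : Pi.single e (1 : ℝ) ∈ LinearMap.ker ℓ := h ▸ Submodule.mem_top
    rw [LinearMap.mem_ker, hℓ] at this
    simpa [Pi.single_apply] using this
  have := Measure.addHaar_submodule (volume : Measure (E → ℝ)) _ htop
  rw [ae_iff]
  convert this using 2
  ext x
  simp [hℓ]

end Perturbation

/-! ### Ground states and gauge transformations -/

section GroundState

variable {V : Type*} (G : SimpleGraph V)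

/-- The product of the spins at the ends of an edge. -/
def edgeSign (τ : V → ℤˣ) (e : G.edgeSet) : ℤˣ := Sym2.mul (Sym2.map τ e.1)

variable {G}

theorem edgeSign_mk {τ : V → ℤˣ} {x y : V} (h : s(x, y) ∈ G.edgeSet) :
    edgeSign G τ ⟨s(x, y), h⟩ = τ x * τ y := rfl

theorem edgeSign_mul (σ τ : V → ℤˣ) (e : G.edgeSet) :
    edgeSign G (σ * τ) e = edgeSign G σ e * edgeSign G τ e := by
  obtain ⟨e, he⟩ := e
  induction e using Sym2.ind with
  | _ x y => simp only [edgeSign_mk, Pi.mul_apply]; exact mul_mul_mul_comm _ _ _ _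

variable [Fintype G.edgeSet]

theorem hamiltonian_eq (J : G.edgeSet → ℝ) (σ : V → ℤˣ) :
    hamiltonian G J σ = -∑ e, J e * ((edgeSign G σ e : ℤ) : ℝ) := rfl

theorem hamiltonian_gauge (J : G.edgeSet → ℝ) (σ τ : V → ℤˣ) :
    hamiltonian G (fun e => ((edgeSign G τ e : ℤ) : ℝ) * J e) σ = hamiltonian G J (σ * τ) := by
  simp only [hamiltonian_eq, edgeSign_mul]
  congr 1
  refine Finset.sum_congr rfl fun e _ => ?_
  push_cast
  ring

theorem units_mul_self_pi (τ : V → ℤˣ) : τ * τ = 1 := funext fun _ => Int.units_mul_self _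

/-- The map `σ ↦ σ * τ` carries one energy landscape to the other and, as `τ = 1` on `B`, preserves
the boundary condition. -/
theorem isGroundState_gauge {B : Finset V} {γ : B → ℤˣ} {τ : V → ℤˣ} (hτ : ∀ i ∈ B, τ i = 1)
    (J : G.edgeSet → ℝ) (σ : V → ℤˣ) :
    IsGroundState G B γ (fun e => ((edgeSign G τ e : ℤ) : ℝ) * J e) σ ↔
      IsGroundState G B γ J (σ * τ) := by
  have hB : ∀ ρ : V → ℤˣ, (∀ i : B, (ρ * τ) i = γ i) ↔ ∀ i : B, ρ i = γ i := fun ρ =>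
    forall_congr' fun i => by rw [Pi.mul_apply, hτ i i.2, mul_one]
  unfold IsGroundState
  rw [hB]
  refine and_congr_right fun _ => ?_
  simp only [hamiltonian_gauge]
  constructor
  · intro h ρ hρ
    have := h (ρ * τ) ((hB ρ).2 hρ)
    rwa [mul_assoc, units_mul_self_pi, mul_one] at this
  · intro h ρ hρ
    exact h _ ((hB ρ).2 hρ)

theorem continuous_hamiltonian (σ : V → ℤˣ) :
    Continuous fun J : G.edgeSet → ℝ => hamiltonian G J σ := by
  simp only [hamiltonian_eq]; fun_prop

theorem measurableSet_isGroundState [Finite V] (B : Finset V) (γ : B → ℤˣ) (σ : V → ℤˣ) :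
    MeasurableSet {J : G.edgeSet → ℝ | IsGroundState G B γ J σ} := by
  by_cases hσ : ∀ i : B, σ i = γ i
  · simp only [IsGroundState, hσ, implies_true, true_and, Set.ofPred_forall]
    exact MeasurableSet.iInter fun τ => MeasurableSet.iInter fun _ =>
      measurableSet_le (continuous_hamiltonian σ).measurable (continuous_hamiltonian τ).measurable
  · simp only [IsGroundState, hσ, false_and]
    exact MeasurableSet.const False

/-- If a spin configuration that is `1` on `B` and equal at the ends of every edge has to be
constant, then almost surely the products `σ i * σ j` agree for all ground states. -/
theorem ae_isGroundState_unique [Finite V] {B : Finset V} {γ : B → ℤˣ}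
    (hconn : ∀ τ : V → ℤˣ, (∀ k ∈ B, τ k = 1) → (∀ e, edgeSign G τ e = 1) →
      ∀ i j, τ i * τ j = 1) :
    ∀ᵐ J ∂(Measure.pi fun _ : G.edgeSet => gaussianReal 0 1), ∀ σ σ' : V → ℤˣ,
      IsGroundState G B γ J σ → IsGroundState G B γ J σ' →
        ∀ i j, σ' i * σ' j = σ i * σ j := by
  -- For each of the finitely many pairs the energy difference is a nonzero linear form in `J`.
  have key : ∀ᵐ J ∂(Measure.pi fun _ : G.edgeSet => gaussianReal 0 1), ∀ σ σ' : V → ℤˣ,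
      edgeSign G σ ≠ edgeSign G σ' → hamiltonian G J σ ≠ hamiltonian G J σ' := by
    rw [ae_all_iff]
    intro σ
    rw [ae_all_iff]
    intro σ'
    by_cases hne : edgeSign G σ = edgeSign G σ'
    · simp [hne]
    have hc : (fun e => ((edgeSign G σ e : ℤ) : ℝ) - ((edgeSign G σ' e : ℤ) : ℝ)) ≠ 0 := by
      intro h
      refine hne (funext fun e => ?_)
      have := congrFun h e
      simp only [Pi.zero_apply, sub_eq_zero, Int.cast_inj] at this
      exact Units.ext this
    filter_upwards [ae_sum_mul_ne_zero hc] with J hJ _ heq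
    rw [hamiltonian_eq, hamiltonian_eq, neg_inj] at heq
    simp only [mul_sub, Finset.sum_sub_distrib] at hJ
    exact hJ (sub_eq_zero.2 heq)
  filter_upwards [key] with J hJ σ σ' hσ hσ' i j
  have hsign : edgeSign G σ = edgeSign G σ' := by
    by_contra hne
    exact hJ σ σ' hne (le_antisymm (hσ.2 σ' hσ'.1) (hσ'.2 σ hσ.1))
  have := hconn (σ * σ') (fun k hk => by
      rw [Pi.mul_apply, hσ.1 ⟨k, hk⟩, hσ'.1 ⟨k, hk⟩, Int.units_mul_self])
    (fun e => by rw [edgeSign_mul, hsign, Int.units_mul_self]) i j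
  rw [Pi.mul_apply, Pi.mul_apply, mul_mul_mul_comm, mul_eq_one_iff_eq_inv, Int.units_inv_eq_self]
    at this
  exact this.symm

variable [Fintype V] [DecidableEq V]

open Classical in
/-- The average of `σ i * σ j` over all ground states in the environment `J`. -/
def meanCorrelation (B : Finset V) (γ : B → ℤˣ) (i j : V) (J : G.edgeSet → ℝ) : ℝ :=
  (∑ σ : V → ℤˣ, if IsGroundState G B γ J σ then (((σ i * σ j : ℤˣ) : ℤ) : ℝ) else 0) /
    ∑ σ : V → ℤˣ, if IsGroundState G B γ J σ then 1 else 0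

theorem measurable_meanCorrelation (B : Finset V) (γ : B → ℤˣ) (i j : V) :
    Measurable (meanCorrelation (G := G) B γ i j) := by
  classical
  unfold meanCorrelation
  refine Measurable.div ?_ ?_ <;>
  exact Finset.measurable_fun_sum _ fun σ _ =>
    Measurable.ite (measurableSet_isGroundState B γ σ) measurable_const measurable_const

theorem abs_units (u : ℤˣ) : |((u : ℤ) : ℝ)| = 1 := by
  rcases Int.units_eq_one_or u with rfl | rfl <;> simp

theorem abs_meanCorrelation_le (B : Finset V) (γ : B → ℤˣ) (i j : V) (J : G.edgeSet → ℝ) :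
    |meanCorrelation B γ i j J| ≤ 1 := by
  classical
  unfold meanCorrelation
  rw [abs_div]
  refine div_le_one_of_le₀ ?_ (abs_nonneg _)
  refine (Finset.abs_sum_le_sum_abs _ _).trans (le_trans ?_ (le_abs_self _))
  refine Finset.sum_le_sum fun σ _ => ?_
  split_ifs
  · exact (abs_units _).le
  · simp

/-- Averaging over all ground states makes the gauge covariance exact for every `J`, including
environments with ties, as `IsFlippable` demands. -/
theorem meanCorrelation_gauge {B : Finset V} {γ : B → ℤˣ} {τ : V → ℤˣ} (hτ : ∀ k ∈ B, τ k = 1)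
    (i j : V) (J : G.edgeSet → ℝ) :
    meanCorrelation B γ i j (fun e => ((edgeSign G τ e : ℤ) : ℝ) * J e) =
      (((τ i * τ j : ℤˣ) : ℤ) : ℝ) * meanCorrelation B γ i j J := by
  classical
  unfold meanCorrelation
  simp only [isGroundState_gauge hτ]
  rw [← mul_div_assoc, Finset.mul_sum]
  congr 1
  · refine Fintype.sum_equiv (Equiv.mulRight τ) _ _ fun σ => ?_
    by_cases hσ : IsGroundState G B γ J (σ * τ)
    · rw [if_pos hσ, if_pos (show IsGroundState G B γ J (Equiv.mulRight τ σ) from hσ)]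
      have hmul : ∀ k, Equiv.mulRight τ σ k = σ k * τ k := fun _ => rfl
      have h : ∀ k, τ k * τ k = 1 := fun k => Int.units_mul_self _
      rw [← Int.cast_mul, ← Units.val_mul, hmul, hmul,
        mul_mul_mul_comm (σ i), mul_left_comm, mul_mul_mul_comm (τ i), h, h]
      simp
    · rw [if_neg hσ, if_neg (show ¬IsGroundState G B γ J (Equiv.mulRight τ σ) from hσ), mul_zero]
  · exact Fintype.sum_equiv (Equiv.mulRight τ) _ _ fun σ => rfl

theorem meanCorrelation_eq {B : Finset V} {γ : B → ℤˣ} {i j : V} {J : G.edgeSet → ℝ}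
    {σ : V → ℤˣ} (hσ : IsGroundState G B γ J σ)
    (huniq : ∀ σ', IsGroundState G B γ J σ' → σ' i * σ' j = σ i * σ j) :
    meanCorrelation B γ i j J = (((σ i * σ j : ℤˣ) : ℤ) : ℝ) := by
  classical
  unfold meanCorrelation
  have hpos : (0 : ℝ) < ∑ σ : V → ℤˣ, if IsGroundState G B γ J σ then 1 else 0 :=
    Finset.sum_pos' (fun _ _ => by split_ifs <;> simp) ⟨σ, Finset.mem_univ _, by simp [hσ]⟩
  rw [div_eq_iff hpos.ne', Finset.mul_sum]
  refine Finset.sum_congr rfl fun σ' _ => ?_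
  split_ifs with h
  · rw [huniq σ' h, mul_one]
  · simp

theorem isFlippable_meanCorrelation {B : Finset V} {γ : B → ℤˣ} {i j : V} {m : ℕ}
    (h : ∀ A : Finset G.edgeSet, A.card < m → ∃ τ : V → ℤˣ, (∀ k ∈ B, τ k = 1) ∧
      (∀ e ∈ A, edgeSign G τ e = 1) ∧ τ i * τ j = -1) :
    IsFlippable m (meanCorrelation (G := G) B γ i j) := by
  intro A hA
  obtain ⟨τ, hτ, hτA, hij⟩ := h A hA
  refine ⟨edgeSign G τ, hτA, fun J => ?_⟩
  rw [meanCorrelation_gauge hτ, hij]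
  simp

theorem siteOverlap_sq (B : Finset V) (σ σ' : V → ℤˣ) :
    siteOverlap B σ σ' ^ 2 = (∑ i ∈ Bᶜ, ∑ j ∈ Bᶜ,
      (((σ i * σ j : ℤˣ) : ℤ) : ℝ) * (((σ' i * σ' j : ℤˣ) : ℤ) : ℝ)) / (Bᶜ.card : ℝ) ^ 2 := by
  rw [siteOverlap, div_pow, sq (∑ i ∈ Bᶜ, _), Finset.sum_mul_sum]
  congr 1
  refine Finset.sum_congr rfl fun i _ => Finset.sum_congr rfl fun j _ => ?_
  push_cast
  ring

/-- This reduces the probabilistic statement to combinatorics: exhibit gauges for small edge sets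
and bound the sum of `(1 - p) ^ m i j`. -/
theorem overlapSecondMomentLE_of_gauge.{w} {B : Finset V} {γ : B → ℤˣ} {p : unitInterval} (h0 : 0 < p)
    (h1 : p < 1)
    (hconn : ∀ τ : V → ℤˣ, (∀ k ∈ B, τ k = 1) → (∀ e, edgeSign G τ e = 1) →
      ∀ i j, τ i * τ j = 1)
    (m : V → V → ℕ)
    (hgauge : ∀ i ∈ Bᶜ, ∀ j ∈ Bᶜ, ∀ A : Finset G.edgeSet, A.card < m i j →
      ∃ τ : V → ℤˣ, (∀ k ∈ B, τ k = 1) ∧ (∀ e ∈ A, edgeSign G τ e = 1) ∧ τ i * τ j = -1)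
    {b : ℝ}
    (hb : (∑ i ∈ Bᶜ, ∑ j ∈ Bᶜ, (1 - p : ℝ) ^ m i j) / (Bᶜ.card : ℝ) ^ 2 ≤ b) :
    OverlapSecondMomentLE.{w} G B γ p b := by
  intro Ω _ P _ J K σ σ' hpert hσ hσ'
  obtain ⟨hJ, hK, hcorr⟩ := isDecorrelated h0 h1 hpert
  have hmeas := fun i j => measurable_meanCorrelation (G := G) B γ i j
  have haeJ := ae_of_ae_map hJ.aemeasurable
    (hJ.map_eq.symm ▸ ae_isGroundState_unique (γ := γ) hconn)
  have haeK := ae_of_ae_map hK.aemeasurable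
    (hK.map_eq.symm ▸ ae_isGroundState_unique (γ := γ) hconn)
  -- Almost sure uniqueness replaces the arbitrary, possibly nonmeasurable, choices of ground states
  -- by measurable functions of the environments.
  have hae : (fun ω => siteOverlap B (σ ω) (σ' ω) ^ 2) =ᵐ[P] fun ω =>
      (∑ i ∈ Bᶜ, ∑ j ∈ Bᶜ, meanCorrelation B γ i j (J ω) * meanCorrelation B γ i j (K ω)) /
        (Bᶜ.card : ℝ) ^ 2 := by
    filter_upwards [hσ, hσ', haeJ, haeK] with ω h h' hu hu'
    rw [siteOverlap_sq]
    congr 1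
    refine Finset.sum_congr rfl fun i _ => Finset.sum_congr rfl fun j _ => ?_
    rw [meanCorrelation_eq h fun τ hτ => hu _ _ h hτ i j,
      meanCorrelation_eq h' fun τ hτ => hu' _ _ h' hτ i j]
  have hint : ∀ i j, Integrable
      (fun ω => meanCorrelation B γ i j (J ω) * meanCorrelation B γ i j (K ω)) P := fun i j =>
    integrable_of_abs_le_one
      (((hmeas i j).comp_aemeasurable hJ.aemeasurable).mul
        ((hmeas i j).comp_aemeasurable hK.aemeasurable)).aestronglyMeasurable
      fun ω => abs_mul_le_one (abs_meanCorrelation_le _ _ _ _ _) (abs_meanCorrelation_le _ _ _ _ _)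
  refine ⟨(integrable_congr hae).2 ((integrable_finsetSum _ fun i _ =>
    integrable_finsetSum _ fun j _ => hint i j).div_const _), le_trans ?_ hb⟩
  rw [integral_congr_ae hae, integral_div, integral_finsetSum _ fun i _ =>
    integrable_finsetSum _ fun j _ => hint i j]
  refine div_le_div_of_nonneg_right (Finset.sum_le_sum fun i hi => ?_) (by positivity)
  rw [integral_finsetSum _ fun j _ => hint i j]
  exact Finset.sum_le_sum fun j hj => hcorr _ _ (hmeas i j) (abs_meanCorrelation_le B γ i j)
    (isFlippable_meanCorrelation (hgauge i hi j hj))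

end GroundState

end EdwardsAnderson

/-! ### Gauges from clusters of a small edge set -/

namespace EdwardsAnderson

section Gauge

variable {V : Type*} {G : SimpleGraph V}

/-- A path inside `A` has distinct edges, so at most `|A|` of them, and `g` changes by at most one
along each. -/
theorem le_add_card_of_reachable {A : Finset G.edgeSet} {g : V → ℕ}
    (hg : ∀ x y, G.Adj x y → g x ≤ g y + 1) {x y : V}
    (h : (SimpleGraph.fromEdgeSet (Subtype.val '' (A : Set G.edgeSet))).Reachable x y) :
    g x ≤ g y + A.card := by
  classical
  obtain ⟨w, hw⟩ := h.exists_isPath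
  have hlip : ∀ {x y : V} (w : (SimpleGraph.fromEdgeSet
      (Subtype.val '' (A : Set G.edgeSet))).Walk x y), g x ≤ g y + w.length := by
    intro x y w
    induction w with
    | nil => simp
    | cons hadj w ih =>
      rw [SimpleGraph.fromEdgeSet_adj] at hadj
      obtain ⟨⟨e, _, he⟩, _⟩ := hadj
      have := hg _ _ ((SimpleGraph.mem_edgeSet G).1 (he ▸ e.2))
      rw [SimpleGraph.Walk.length_cons]
      omega
  have hlen : w.length ≤ A.card := by
    rw [← w.length_edges, ← List.toFinset_card_of_nodup hw.isTrail.edges_nodup,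
      ← Finset.card_image_of_injective A Subtype.val_injective]
    refine Finset.card_le_card fun e he => ?_
    have := w.edges_subset_edgeSet (List.mem_toFinset.1 he)
    rw [SimpleGraph.edgeSet_fromEdgeSet] at this
    simpa using this.1
  exact (hlip w).trans (by omega)

/-- Take `τ = -1` exactly on the `A`-cluster of `i`: no edge of `A` leaves it. -/
theorem exists_gauge_of_not_reachable {A : Finset G.edgeSet} {B : Finset V} {i j : V}
    (hij : ¬(SimpleGraph.fromEdgeSet (Subtype.val '' (A : Set G.edgeSet))).Reachable i j)
    (hB : ∀ k ∈ B, ¬(SimpleGraph.fromEdgeSet (Subtype.val '' (A : Set G.edgeSet))).Reachable i k) :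
    ∃ τ : V → ℤˣ, (∀ k ∈ B, τ k = 1) ∧ (∀ e ∈ A, edgeSign G τ e = 1) ∧ τ i * τ j = -1 := by
  classical
  set H := SimpleGraph.fromEdgeSet (Subtype.val '' (A : Set G.edgeSet)) with hH
  refine ⟨fun v => if H.Reachable i v then -1 else 1, fun k hk => if_neg (hB k hk), ?_, ?_⟩
  · rintro ⟨e, he⟩ heA
    induction e using Sym2.ind with
    | _ x y =>
      have hadj : H.Adj x y := by
        rw [hH, SimpleGraph.fromEdgeSet_adj]
        exact ⟨⟨_, heA, rfl⟩, ((SimpleGraph.mem_edgeSet G).1 he).ne⟩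
      have hxy : H.Reachable i x ↔ H.Reachable i y :=
        ⟨fun h => h.trans hadj.reachable, fun h => h.trans hadj.symm.reachable⟩
      rw [edgeSign_mk]
      simp only [hxy]
      exact Int.units_mul_self _
  · simp [hij]

theorem exists_gauge_of_card_lt {A : Finset G.edgeSet} {i j : V} {D : V → V → ℕ}
    (hD0 : ∀ x, D x x = 0) (hD : ∀ x y z, G.Adj x y → D x z ≤ D y z + 1) (hA : A.card < D i j) :
    ∃ τ : V → ℤˣ, (∀ k ∈ (∅ : Finset V), τ k = 1) ∧ (∀ e ∈ A, edgeSign G τ e = 1) ∧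
      τ i * τ j = -1 := by
  refine exists_gauge_of_not_reachable (fun h => ?_) (by simp)
  have := le_add_card_of_reachable (g := fun x => D x j) (fun x y => hD x y j) h
  simp only [hD0] at this
  omega

/-- It suffices that one of the two clusters misses `B`, since only that one is flipped; hence the
maximum. -/
theorem exists_gauge_of_card_lt_min {A : Finset G.edgeSet} {B : Finset V} {i j : V}
    {D : V → V → ℕ} {b : V → ℕ}
    (hD0 : ∀ x, D x x = 0) (hD : ∀ x y z, G.Adj x y → D x z ≤ D y z + 1)
    (hb0 : ∀ x ∈ B, b x = 0) (hb : ∀ x y, G.Adj x y → b x ≤ b y + 1)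
    (hA : A.card < min (D i j) (max (b i) (b j))) :
    ∃ τ : V → ℤˣ, (∀ k ∈ B, τ k = 1) ∧ (∀ e ∈ A, edgeSign G τ e = 1) ∧ τ i * τ j = -1 := by
  rw [lt_min_iff, lt_max_iff] at hA
  have hij : ¬(SimpleGraph.fromEdgeSet (Subtype.val '' (A : Set G.edgeSet))).Reachable i j := by
    intro h
    have := le_add_card_of_reachable (g := fun x => D x j) (fun x y => hD x y j) h
    simp only [hD0] at this
    omega
  have hfar : ∀ x, A.card < b x → ∀ k ∈ B,
      ¬(SimpleGraph.fromEdgeSet (Subtype.val '' (A : Set G.edgeSet))).Reachable x k := by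
    intro x hx k hk h
    have := le_add_card_of_reachable hb h
    rw [hb0 k hk] at this
    omega
  rcases hA.2 with h | h
  · exact exists_gauge_of_not_reachable hij (hfar i h)
  · obtain ⟨τ, h1, h2, h3⟩ := exists_gauge_of_not_reachable (fun h => hij h.symm) (hfar j h)
    exact ⟨τ, h1, h2, by rwa [mul_comm]⟩

end Gauge

/-! ### Geometric sums -/

section Sums

theorem sum_pow_le_of_injOn {ι : Type*} {s : Finset ι} {h : ι → ℕ} (hinj : Set.InjOn h s)
    {q : ℝ} (h0 : 0 ≤ q) (h1 : q < 1) : ∑ x ∈ s, q ^ h x ≤ (1 - q)⁻¹ := by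
  rw [← Finset.sum_image (f := fun n => q ^ n) hinj, ← tsum_geometric_of_lt_one h0 h1]
  exact (summable_geometric_of_lt_one h0 h1).sum_le_tsum _ fun n _ => pow_nonneg h0 n

/-- Intended for distances to a point on a line or circle, which are injective on each side of the
point. -/
theorem sum_pow_le_of_injOn_of_injOn_not {ι : Type*} {s : Finset ι} {h : ι → ℕ} (P : ι → Prop)
    (hP : Set.InjOn h {x | P x}) (hP' : Set.InjOn h {x | ¬P x})
    {q : ℝ} (h0 : 0 ≤ q) (h1 : q < 1) : ∑ x ∈ s, q ^ h x ≤ 2 * (1 - q)⁻¹ := by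
  classical
  rw [← Finset.sum_filter_add_sum_filter_not s P, two_mul]
  exact add_le_add
    (sum_pow_le_of_injOn (hP.mono fun x hx => (Finset.mem_filter.1 hx).2) h0 h1)
    (sum_pow_le_of_injOn (hP'.mono fun x hx => (Finset.mem_filter.1 hx).2) h0 h1)

theorem sum_pi_prod {d : ℕ} {T : Type*} [Fintype T] (F : Fin d → T → ℝ) :
    ∑ y : Fin d → T, ∏ k, F k (y k) = ∏ k, ∑ t, F k t := by
  rw [Finset.prod_univ_sum, Fintype.piFinset_univ]

theorem sum_pow_sum_le {d : ℕ} {T : Type*} [Fintype T] {h : Fin d → T → ℕ} {q c : ℝ}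
    (h0 : 0 ≤ q) (hc : ∀ k, ∑ t, q ^ h k t ≤ c) :
    ∑ y : Fin d → T, q ^ (∑ k, h k (y k)) ≤ c ^ d := by
  simp_rw [← Finset.prod_pow_eq_pow_sum]
  rw [sum_pi_prod fun k t => q ^ h k t]
  refine (Finset.prod_le_prod (fun k _ => Finset.sum_nonneg fun t _ => pow_nonneg h0 _)
    fun k _ => hc k).trans ?_
  simp

theorem sum_apply_eq {d : ℕ} {T : Type*} [Fintype T] (F : T → ℝ) (k : Fin d) :
    ∑ y : Fin d → T, F (y k) = (Fintype.card T : ℝ) ^ (d - 1) * ∑ t, F t := by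
  classical
  have := sum_pi_prod fun (l : Fin d) (t : T) => if l = k then F t else 1
  simp only [Finset.prod_ite_eq', Finset.mem_univ, if_true] at this
  rw [this, ← Finset.mul_prod_erase _ _ (Finset.mem_univ k), mul_comm]
  congr 1
  · rw [Finset.prod_congr rfl fun l hl => by
      simp only [if_neg (Finset.ne_of_mem_erase hl), Finset.sum_const, nsmul_eq_mul, mul_one]
      rfl]
    simp
  · simp

theorem sum_le_sum_add_one {ι : Type*} [Fintype ι] {a b : ι → ℕ} (k : ι)
    (h : ∀ l, l ≠ k → a l = b l) (hk : a k ≤ b k + 1) : ∑ l, a l ≤ ∑ l, b l + 1 := by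
  classical
  calc ∑ l, a l ≤ ∑ l, (b l + if l = k then 1 else 0) := Finset.sum_le_sum fun l _ => by
        by_cases hl : l = k
        · subst hl; simpa using hk
        · simp [h l hl, hl]
    _ = _ := by simp [Finset.sum_add_distrib]

end Sums

section Free

variable {V : Type*} [Fintype V] [DecidableEq V] {G : SimpleGraph V} [Fintype G.edgeSet]

theorem overlapSecondMomentLE_free.{w} [Nonempty V] {γ : (∅ : Finset V) → ℤˣ} {p : unitInterval}
    (h0 : 0 < p) (h1 : p < 1)
    (hconn : ∀ τ : V → ℤˣ, (∀ e, edgeSign G τ e = 1) → ∀ i j, τ i * τ j = 1)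
    {D : V → V → ℕ} (hD0 : ∀ x, D x x = 0) (hD : ∀ x y z, G.Adj x y → D x z ≤ D y z + 1)
    {c : ℝ} (hsum : ∀ x, ∑ y, (1 - p : ℝ) ^ D x y ≤ c) :
    OverlapSecondMomentLE.{w} G ∅ γ p (c / Fintype.card V) := by
  refine overlapSecondMomentLE_of_gauge h0 h1 (fun τ _ => hconn τ) D
    (fun i _ j _ A hA => exists_gauge_of_card_lt hD0 hD hA) ?_
  have hV : (0 : ℝ) < Fintype.card V := by exact_mod_cast Fintype.card_pos
  rw [Finset.compl_empty, Finset.card_univ, div_le_div_iff₀ (by positivity) hV]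
  have : ∑ x : V, ∑ y, (1 - p : ℝ) ^ D x y ≤ Fintype.card V * c :=
    (Finset.sum_le_sum fun x _ => hsum x).trans (by simp)
  nlinarith

end Free

/-! ### The torus -/

section Torus

/-- The `ℓ¹` distance on the discrete torus. -/
def torusDist {d L : ℕ} (x y : Fin d → ZMod L) : ℕ := ∑ k, (x k - y k).valMinAbs.natAbs

theorem torusDist_self {d L : ℕ} (x : Fin d → ZMod L) : torusDist x x = 0 := by
  simp [torusDist]

theorem torusDist_le {d L : ℕ} [NeZero L] (x y z : Fin d → ZMod L) (h : (torus d L).Adj x y) :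
    torusDist x z ≤ torusDist y z + 1 := by
  obtain ⟨_, k, hk, hl⟩ := h
  refine sum_le_sum_add_one k (fun l hlk => by rw [hl l hlk]) ?_
  have h1 : (1 : ZMod L).valMinAbs.natAbs ≤ 1 := by
    rw [ZMod.valMinAbs_natAbs_eq_min]
    refine (min_le_left _ _).trans ?_
    rcases (Nat.one_le_iff_ne_zero.2 (NeZero.ne L)).eq_or_lt with h | h
    · subst h; decide
    · have : Fact (1 < L) := ⟨h⟩
      rw [ZMod.val_one]
  rcases hk with hk | hk
  · have e : x k - z k = (y k - z k) + -1 := by rw [← hk]; ring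
    rw [e]
    refine (ZMod.natAbs_valMinAbs_add_le _ _).trans ?_
    refine (Int.natAbs_add_le _ _).trans ?_
    rw [ZMod.natAbs_valMinAbs_neg]
    omega
  · have e : x k - z k = (y k - z k) + 1 := by rw [← hk]; ring
    rw [e]
    refine (ZMod.natAbs_valMinAbs_add_le _ _).trans ?_
    refine (Int.natAbs_add_le _ _).trans ?_
    omega

/-- The translations preserving `τ` form a subgroup, and the unit vectors in it generate everything.
-/
theorem torus_connected {d L : ℕ} [NeZero L] (τ : (Fin d → ZMod L) → ℤˣ)
    (hτ : ∀ e, edgeSign (torus d L) τ e = 1) (i j : Fin d → ZMod L) : τ i * τ j = 1 := by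
  let S : AddSubgroup (Fin d → ZMod L) :=
    { carrier := {v | ∀ x, τ (x + v) = τ x}
      zero_mem' := fun x => by rw [add_zero]
      add_mem' := fun {a b} ha hb x => by rw [← add_assoc, hb, ha]
      neg_mem' := fun {a} ha x => by
        have := ha (x + -a)
        rw [neg_add_cancel_right] at this
        exact this.symm }
  have hS : ∀ v, v ∈ S ↔ ∀ x, τ (x + v) = τ x := fun v => Iff.rfl
  have h1 : ∀ k, Pi.single k (1 : ZMod L) ∈ S := by
    intro k
    rw [hS]
    intro x
    -- This case occurs for `L = 1`, where the would-be edge is a loop and is absent from the graph.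
    by_cases hx : x + Pi.single k 1 = x
    · rw [hx]
    · have hadj : (torus d L).Adj x (x + Pi.single k 1) :=
        ⟨Ne.symm hx, k, Or.inl (by simp), fun l hl => by simp [Pi.single_eq_of_ne hl]⟩
      have := hτ ⟨s(x, x + Pi.single k 1), (SimpleGraph.mem_edgeSet _).2 hadj⟩
      rw [edgeSign_mk, mul_eq_one_iff_eq_inv, Int.units_inv_eq_self] at this
      exact this.symm
  have hall : ∀ v, v ∈ S := by
    intro v
    have hv : v = ∑ k, (v k).val • Pi.single k (1 : ZMod L) := by
      conv_lhs => rw [← Finset.univ_sum_single v]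
      refine Finset.sum_congr rfl fun k _ => ?_
      rw [← Pi.single_smul]
      simp
    rw [hv]
    exact S.sum_mem fun k _ => S.nsmul_mem (h1 k) _
  have := (hS (j - i)).1 (hall _) i
  rw [add_sub_cancel] at this
  rw [this, Int.units_mul_self]

theorem overlapSecondMomentLE_torus.{w} (d L : ℕ) [NeZero L]
    (γ : (∅ : Finset (Fin d → ZMod L)) → ℤˣ) {p : unitInterval} (h0 : 0 < p) (h1 : p < 1) :
    OverlapSecondMomentLE.{w} (torus d L) ∅ γ p ((2 * (p : ℝ)⁻¹) ^ d / (L : ℝ) ^ d) := by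
  have hp0 : (0 : ℝ) < p := by exact_mod_cast h0
  have hsum : ∀ x : Fin d → ZMod L, ∑ y, (1 - p : ℝ) ^ torusDist x y ≤ (2 * (p : ℝ)⁻¹) ^ d := by
    intro x
    refine sum_pow_sum_le (h := fun k t => (x k - t).valMinAbs.natAbs)
      (sub_nonneg.2 p.2.2) fun k => ?_
    have := sum_pow_le_of_injOn_of_injOn_not (s := (Finset.univ : Finset (ZMod L)))
      (h := fun t => (x k - t).valMinAbs.natAbs) (q := 1 - p)
      (fun t => 0 ≤ (x k - t).valMinAbs) ?_ ?_ (sub_nonneg.2 p.2.2) (by linarith)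
    · rwa [sub_sub_cancel] at this
    all_goals
      intro s hs t ht hst
      simp only [Set.mem_ofPred_eq] at hs ht hst
      exact sub_right_injective (b := x k) (ZMod.injective_valMinAbs (by dsimp only; omega))
  simpa using overlapSecondMomentLE_free.{0, w} (G := torus d L) (γ := γ) h0 h1 torus_connected torusDist_self
    torusDist_le hsum

end Torus

/-! ### The cube with free or fixed boundary -/

section Cube

variable {d L : ℕ}

/-- The `ℓ¹` distance on the cube. -/
def cubeDist (x y : Fin d → Fin (L + 1)) : ℕ :=
  ∑ k, (((x k : ℕ) - y k) + ((y k : ℕ) - x k))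

theorem cubeDist_self (x : Fin d → Fin (L + 1)) : cubeDist x x = 0 := by
  simp [cubeDist]

theorem cubeDist_le (x y z : Fin d → Fin (L + 1)) (h : (cube d L).Adj x y) :
    cubeDist x z ≤ cubeDist y z + 1 := by
  obtain ⟨k, hk, hl⟩ := h
  refine sum_le_sum_add_one k (fun l hlk => by rw [hl l hlk]) ?_
  omega

theorem cube_connected (τ : (Fin d → Fin (L + 1)) → ℤˣ)
    (hτ : ∀ e, edgeSign (cube d L) τ e = 1) (i j : Fin d → Fin (L + 1)) : τ i * τ j = 1 := by
  have h : ∀ n : ℕ, ∀ x : Fin d → Fin (L + 1), ∑ k, (x k : ℕ) = n → τ x = τ 0 := by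
    intro n
    induction n with
    | zero =>
      intro x hx
      congr 1
      funext k
      exact Fin.ext (Finset.sum_eq_zero_iff.1 hx k (Finset.mem_univ k))
    | succ n ih =>
      intro x hx
      obtain ⟨k, -, hk⟩ : ∃ k ∈ Finset.univ, (x k : ℕ) ≠ 0 :=
        Finset.exists_ne_zero_of_sum_ne_zero (by omega)
      let y : Fin d → Fin (L + 1) := Function.update x k ⟨x k - 1, by omega⟩
      have hyk : (y k : ℕ) = x k - 1 := by simp [y]
      have hyl : ∀ l, l ≠ k → y l = x l := fun l hl => Function.update_of_ne hl _ _
      have hadj : (cube d L).Adj x y :=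
        ⟨k, Or.inr (by omega), fun l hl => (hyl l hl).symm⟩
      have := hτ ⟨s(x, y), (SimpleGraph.mem_edgeSet _).2 hadj⟩
      rw [edgeSign_mk, mul_eq_one_iff_eq_inv, Int.units_inv_eq_self] at this
      rw [this]
      refine ih y ?_
      rw [← Finset.add_sum_erase _ _ (Finset.mem_univ k)] at hx ⊢
      rw [Finset.sum_congr rfl fun l hl => by rw [hyl l (Finset.ne_of_mem_erase hl)], hyk]
      omega
  rw [h _ i rfl, h _ j rfl, Int.units_mul_self]

theorem sum_pow_cubeDist_le {q : ℝ} (h0 : 0 ≤ q) (h1 : q < 1) (x : Fin d → Fin (L + 1)) :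
    ∑ y, q ^ cubeDist x y ≤ (2 * (1 - q)⁻¹) ^ d := by
  refine sum_pow_sum_le (h := fun k (t : Fin (L + 1)) => ((x k : ℕ) - t) + ((t : ℕ) - x k)) h0 fun k => ?_
  refine sum_pow_le_of_injOn_of_injOn_not (s := (Finset.univ : Finset (Fin (L + 1))))
    (h := fun t => ((x k : ℕ) - t) + ((t : ℕ) - x k)) (fun t => x k ≤ t) ?_ ?_ h0 h1
  all_goals
    intro s hs t ht hst
    simp only [Set.mem_ofPred_eq, Fin.le_def] at hs ht hst
    exact Fin.ext (by omega)

theorem overlapSecondMomentLE_cube_free.{w} (d L : ℕ)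
    (γ : (∅ : Finset (Fin d → Fin (L + 1))) → ℤˣ) {p : unitInterval} (h0 : 0 < p) (h1 : p < 1) :
    OverlapSecondMomentLE.{w} (cube d L) ∅ γ p ((2 * (p : ℝ)⁻¹) ^ d / ((L : ℝ) + 1) ^ d) := by
  have hp0 : (0 : ℝ) < p := by exact_mod_cast h0
  have hsum : ∀ x : Fin d → Fin (L + 1),
      ∑ y, (1 - p : ℝ) ^ cubeDist x y ≤ (2 * (p : ℝ)⁻¹) ^ d := fun x => by
    have := sum_pow_cubeDist_le (q := 1 - p) (sub_nonneg.2 p.2.2) (by linarith) x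
    rwa [sub_sub_cancel] at this
  simpa using overlapSecondMomentLE_free.{0, w} (G := cube d L) (γ := γ) h0 h1 cube_connected cubeDist_self
    cubeDist_le hsum

/-- The distance to the boundary of the cube. -/
def boundaryDist (x : Fin d → Fin (L + 1)) : ℕ := ⨅ k, min (x k : ℕ) (L - x k)

theorem boundaryDist_le_apply (x : Fin d → Fin (L + 1)) (k : Fin d) :
    boundaryDist x ≤ min (x k : ℕ) (L - x k) :=
  ciInf_le (OrderBot.bddBelow _) k

theorem exists_boundaryDist_eq [NeZero d] (x : Fin d → Fin (L + 1)) :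
    ∃ k, boundaryDist x = min (x k : ℕ) (L - x k) := by
  obtain ⟨k, hk⟩ := exists_eq_ciInf_of_finite (f := fun k => min (x k : ℕ) (L - x k))
  exact ⟨k, hk.symm⟩

theorem boundaryDist_of_mem (x : Fin d → Fin (L + 1)) (hx : x ∈ cubeBoundary d L) :
    boundaryDist x = 0 := by
  obtain ⟨k, hk⟩ := (Finset.mem_filter.1 hx).2
  have := boundaryDist_le_apply x k
  rcases hk with hk | hk <;> simpa [hk] using this

theorem boundaryDist_le [NeZero d] (x y : Fin d → Fin (L + 1)) (h : (cube d L).Adj x y) :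
    boundaryDist x ≤ boundaryDist y + 1 := by
  obtain ⟨l, hl⟩ := exists_boundaryDist_eq y
  refine (boundaryDist_le_apply x l).trans ?_
  rw [hl]
  obtain ⟨k, hk, hne⟩ := h
  by_cases hlk : l = k
  · subst hlk; omega
  · rw [hne l hlk]; omega

/-- The power of the minimum is at most the sum over the `2 d` faces; each face gives a geometric
series in one coordinate and `(L + 1) ^ (d - 1)` choices of the others. -/
theorem sum_pow_boundaryDist_le [NeZero d] {r : ℝ} (h0 : 0 ≤ r) (h1 : r < 1) :
    ∑ x : Fin d → Fin (L + 1), r ^ boundaryDist x ≤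
      d * (((L : ℝ) + 1) ^ (d - 1) * (2 * (1 - r)⁻¹)) := by
  have hle : ∀ x : Fin d → Fin (L + 1),
      r ^ boundaryDist x ≤ ∑ k, (r ^ (x k : ℕ) + r ^ (L - x k)) := by
    intro x
    obtain ⟨k, hk⟩ := exists_boundaryDist_eq x
    refine le_trans ?_ (Finset.single_le_sum (f := fun k => r ^ (x k : ℕ) + r ^ (L - x k))
      (fun k _ => by positivity) (Finset.mem_univ k))
    rw [hk]
    rcases min_choice (x k : ℕ) (L - x k) with h | h <;> rw [h]
    · exact le_add_of_nonneg_right (by positivity)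
    · exact le_add_of_nonneg_left (by positivity)
  have hedge : ∑ t : Fin (L + 1), (r ^ (t : ℕ) + r ^ (L - t)) ≤ 2 * (1 - r)⁻¹ := by
    rw [Finset.sum_add_distrib, two_mul]
    refine add_le_add (sum_pow_le_of_injOn (fun s _ t _ hst => Fin.ext hst) h0 h1)
      (sum_pow_le_of_injOn (fun s _ t _ hst => ?_) h0 h1)
    have hst' : L - (s : ℕ) = L - t := hst
    exact Fin.ext (by omega)
  calc ∑ x : Fin d → Fin (L + 1), r ^ boundaryDist x
      ≤ ∑ x : Fin d → Fin (L + 1), ∑ k, (r ^ (x k : ℕ) + r ^ (L - x k)) :=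
        Finset.sum_le_sum fun x _ => hle x
    _ = ∑ _k : Fin d, ((L : ℝ) + 1) ^ (d - 1) *
          ∑ t : Fin (L + 1), (r ^ (t : ℕ) + r ^ (L - t)) := by
        rw [Finset.sum_comm]
        refine Finset.sum_congr rfl fun k _ => ?_
        rw [sum_apply_eq (fun t : Fin (L + 1) => r ^ (t : ℕ) + r ^ (L - t)) k]
        simp
    _ ≤ ∑ _k : Fin d, ((L : ℝ) + 1) ^ (d - 1) * (2 * (1 - r)⁻¹) := by gcongr
    _ = _ := by simp

theorem le_card_compl_cubeBoundary (d L : ℕ) : (L - 1) ^ d ≤ (cubeBoundary d L)ᶜ.card := by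
  have hsub : (Fintype.piFinset fun _ : Fin d => ({0, Fin.last L}ᶜ : Finset (Fin (L + 1)))) ⊆
      (cubeBoundary d L)ᶜ := by
    intro x hx
    simp only [Fintype.mem_piFinset, Finset.mem_compl, Finset.mem_insert, Finset.mem_singleton]
      at hx
    simp only [cubeBoundary, Finset.compl_filter, Finset.mem_filter, Finset.mem_univ, true_and,
      not_exists]
    exact hx
  refine le_trans ?_ (Finset.card_le_card hsub)
  rw [Fintype.card_piFinset_const, Finset.card_compl, Fintype.card_fin]
  refine Nat.pow_le_pow_left ?_ d
  have : ({0, Fin.last L} : Finset (Fin (L + 1))).card ≤ 2 := Finset.card_le_two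
  omega

/-- As `max a b ≥ (a + b) / 2`, the boundary part factorizes, so that its double sum over `i` and
`j` becomes a square. -/
theorem pow_min_max_le {q : ℝ} (h0 : 0 ≤ q) (h1 : q ≤ 1) (u a b : ℕ) :
    q ^ min u (max a b) ≤ q ^ u + √q ^ a * √q ^ b := by
  have hr0 := Real.sqrt_nonneg q
  have hr1 : √q ≤ 1 := Real.sqrt_le_one.2 h1
  have hmax : q ^ max a b ≤ √q ^ a * √q ^ b := by
    conv_lhs => rw [← Real.sq_sqrt h0]
    rw [← pow_mul, ← pow_add]
    exact pow_le_pow_of_le_one hr0 hr1 (by omega)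
  rcases min_choice u (max a b) with h | h <;> rw [h]
  · exact le_add_of_nonneg_right (by positivity)
  · exact hmax.trans (le_add_of_nonneg_left (by positivity))

/-- With `n` interior sites, of order `L ^ d`, the bulk term is `n (2 / p) ^ d / n ^ 2`. The
boundary term is `(S / n) ^ 2` with `S` of order at most `L ^ (d - 1) / p`. -/
theorem boundary_sum_le [NeZero d] (hL : 2 ≤ L) {p : ℝ} (h0 : 0 < p) (h1 : p < 1) :
    (∑ i ∈ (cubeBoundary d L)ᶜ, ∑ j ∈ (cubeBoundary d L)ᶜ,
      (1 - p) ^ min (cubeDist i j) (max (boundaryDist i) (boundaryDist j))) /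
        ((cubeBoundary d L)ᶜ.card : ℝ) ^ 2 ≤
      4 ^ d * ((L : ℝ)⁻¹ * p⁻¹) ^ d + (2 * d * 4 ^ d) ^ 2 * ((L : ℝ)⁻¹ * p⁻¹) ^ 2 := by
  set n : ℝ := ((cubeBoundary d L)ᶜ.card : ℝ) with hn
  have hLpos : (0 : ℝ) < L := by positivity
  have hLn : ((L : ℝ) / 2) ^ d ≤ n := by
    have h2 : (((L - 1 : ℕ) : ℝ)) ^ d ≤ n := by
      rw [hn]; exact_mod_cast le_card_compl_cubeBoundary d L
    refine le_trans (pow_le_pow_left₀ (by positivity) ?_ d) h2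
    rw [Nat.cast_sub (by omega)]
    have : (2 : ℝ) ≤ L := by exact_mod_cast hL
    push_cast
    linarith
  have hnpos : 0 < n := lt_of_lt_of_le (by positivity) hLn
  have hq0 : 0 ≤ 1 - p := by linarith
  set r := √(1 - p) with hr
  have hr0 : 0 ≤ r := Real.sqrt_nonneg _
  have hr1 : p / 2 ≤ 1 - r := by
    have : r ≤ 1 - p / 2 := Real.sqrt_le_iff.2 ⟨by linarith, by nlinarith⟩
    linarith
  set S := ∑ i ∈ (cubeBoundary d L)ᶜ, r ^ boundaryDist i with hS
  have hS0 : 0 ≤ S := Finset.sum_nonneg fun i _ => by positivity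
  have hSle : S ≤ d * ((2 * (L : ℝ)) ^ (d - 1) * (4 * p⁻¹)) := by
    refine (Finset.sum_le_univ_sum_of_nonneg fun i => by positivity).trans
      ((sum_pow_boundaryDist_le hr0 (by linarith)).trans ?_)
    have h3 : (1 - r)⁻¹ ≤ 2 * p⁻¹ := by
      calc (1 - r)⁻¹ ≤ (p / 2)⁻¹ := inv_anti₀ (by positivity) hr1
        _ = 2 * p⁻¹ := by field_simp
    have h4 : (L : ℝ) + 1 ≤ 2 * L := by
      have : (2 : ℝ) ≤ L := by exact_mod_cast hL
      linarith
    have h5 : 2 * (1 - r)⁻¹ ≤ 4 * p⁻¹ := by linarith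
    have h6 : 0 ≤ 2 * (1 - r)⁻¹ := by
      have : 0 < 1 - r := by linarith
      positivity
    gcongr
  have hsum : ∑ i ∈ (cubeBoundary d L)ᶜ, ∑ j ∈ (cubeBoundary d L)ᶜ,
      (1 - p) ^ min (cubeDist i j) (max (boundaryDist i) (boundaryDist j)) ≤
      n * (2 * p⁻¹) ^ d + S ^ 2 := by
    calc _ ≤ ∑ i ∈ (cubeBoundary d L)ᶜ, ∑ j ∈ (cubeBoundary d L)ᶜ,
          ((1 - p) ^ cubeDist i j + r ^ boundaryDist i * r ^ boundaryDist j) :=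
          Finset.sum_le_sum fun i _ => Finset.sum_le_sum fun j _ =>
            pow_min_max_le hq0 (by linarith) _ _ _
      _ = ∑ i ∈ (cubeBoundary d L)ᶜ, ∑ j ∈ (cubeBoundary d L)ᶜ, (1 - p) ^ cubeDist i j +
          S ^ 2 := by
          simp only [Finset.sum_add_distrib]
          rw [sq, hS, Finset.sum_mul_sum]
      _ ≤ ∑ i ∈ (cubeBoundary d L)ᶜ, (2 * p⁻¹) ^ d + S ^ 2 := by
          gcongr with i _
          refine (Finset.sum_le_univ_sum_of_nonneg fun j => by positivity).trans ?_
          have := sum_pow_cubeDist_le hq0 (by linarith) i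
          rwa [sub_sub_cancel] at this
      _ = _ := by rw [Finset.sum_const, nsmul_eq_mul]
  have hdiv1 : n * (2 * p⁻¹) ^ d / n ^ 2 ≤ 4 ^ d * ((L : ℝ)⁻¹ * p⁻¹) ^ d := by
    calc n * (2 * p⁻¹) ^ d / n ^ 2 = (2 * p⁻¹) ^ d / n := by field_simp
      _ ≤ (2 * p⁻¹) ^ d / ((L : ℝ) / 2) ^ d := by gcongr
      _ = (4 * ((L : ℝ)⁻¹ * p⁻¹)) ^ d := by
          rw [← div_pow]; congr 1; field_simp; norm_num
      _ = _ := mul_pow _ _ _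
  have hdiv2 : S / n ≤ 2 * d * 4 ^ d * ((L : ℝ)⁻¹ * p⁻¹) := by
    obtain ⟨e, rfl⟩ : ∃ e, d = e + 1 := Nat.exists_eq_succ_of_ne_zero (NeZero.ne d)
    calc S / n ≤ (((e + 1 : ℕ) : ℝ) * ((2 * (L : ℝ)) ^ e * (4 * p⁻¹))) / ((L : ℝ) / 2) ^ (e + 1) := by
          gcongr
          exact hSle
      _ = _ := by
          rw [show (4 : ℝ) = 2 * 2 by norm_num]
          simp only [mul_pow, div_pow, pow_succ]
          field_simp
  calc _ ≤ (n * (2 * p⁻¹) ^ d + S ^ 2) / n ^ 2 := by gcongr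
    _ = n * (2 * p⁻¹) ^ d / n ^ 2 + (S / n) ^ 2 := by rw [add_div, div_pow]
    _ ≤ 4 ^ d * ((L : ℝ)⁻¹ * p⁻¹) ^ d + (2 * d * 4 ^ d * ((L : ℝ)⁻¹ * p⁻¹)) ^ 2 := by gcongr
    _ = _ := by rw [mul_pow _ ((L : ℝ)⁻¹ * p⁻¹)]

theorem boundary_sum_le_one {p : ℝ} (h0 : 0 < p) (h1 : p < 1) (m : (Fin d → Fin (L + 1)) →
    (Fin d → Fin (L + 1)) → ℕ) (B : Finset (Fin d → Fin (L + 1))) :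
    (∑ i ∈ Bᶜ, ∑ j ∈ Bᶜ, (1 - p) ^ m i j) / (Bᶜ.card : ℝ) ^ 2 ≤ 1 := by
  refine div_le_one_of_le₀ ?_ (by positivity)
  calc ∑ i ∈ Bᶜ, ∑ j ∈ Bᶜ, (1 - p) ^ m i j ≤ ∑ i ∈ Bᶜ, ∑ j ∈ Bᶜ, (1 : ℝ) :=
        Finset.sum_le_sum fun i _ => Finset.sum_le_sum fun j _ =>
          pow_le_one₀ (by linarith) (by linarith)
    _ = _ := by simp [sq]

/-- A constant for which the bounds on the second moment of the overlap hold. -/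
def overlapConstant (d : ℕ) : ℝ := 4 ^ d + (2 * d * 4 ^ d) ^ 2

theorem one_le_overlapConstant (d : ℕ) : 1 ≤ overlapConstant d := by
  have : (1 : ℝ) ≤ 4 ^ d := one_le_pow₀ (by norm_num)
  unfold overlapConstant
  nlinarith [sq_nonneg (2 * (d : ℝ) * 4 ^ d)]

theorem two_pow_le_overlapConstant (d : ℕ) : 2 ^ d ≤ overlapConstant d := by
  have : (2 : ℝ) ^ d ≤ 4 ^ d := pow_le_pow_left₀ (by norm_num) (by norm_num) d
  unfold overlapConstant
  nlinarith [sq_nonneg (2 * (d : ℝ) * 4 ^ d)]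

theorem overlapSecondMomentLE_cube_boundary.{w} [NeZero d] (hL : 2 ≤ L)
    (γ : cubeBoundary d L → ℤˣ) {p : unitInterval} (h0 : 0 < p) (h1 : p < 1) {s : ℕ}
    (hsd : s ≤ d) (hs2 : s ≤ 2) :
    OverlapSecondMomentLE.{w} (cube d L) (cubeBoundary d L) γ p
      (overlapConstant d * ((L : ℝ)⁻¹ * (p : ℝ)⁻¹) ^ s) := by
  have hp0 : (0 : ℝ) < p := by exact_mod_cast h0
  have hp1 : (p : ℝ) < 1 := by exact_mod_cast h1
  refine overlapSecondMomentLE_of_gauge h0 h1 (fun τ _ => cube_connected τ)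
    (fun i j => min (cubeDist i j) (max (boundaryDist i) (boundaryDist j)))
    (fun i _ j _ A hA => exists_gauge_of_card_lt_min cubeDist_self cubeDist_le
      boundaryDist_of_mem boundaryDist_le hA) ?_
  set x := (L : ℝ)⁻¹ * (p : ℝ)⁻¹ with hx
  have hx0 : 0 ≤ x := by positivity
  have hC := one_le_overlapConstant d
  -- For `L p ≤ 1` the trivial bound `1` suffices. Otherwise `x ≤ 1`, and both exponents `d` and `2`
  -- may be lowered to `s`.
  rcases le_total 1 x with h | h
  · refine (boundary_sum_le_one hp0 hp1 _ _).trans ?_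
    exact one_le_mul_of_one_le_of_one_le hC (one_le_pow₀ h)
  · refine (boundary_sum_le hL hp0 hp1).trans ?_
    rw [← hx, overlapConstant, add_mul]
    gcongr ?_ * ?_ + ?_ * ?_
    · exact pow_le_pow_of_le_one hx0 h hsd
    · exact pow_le_pow_of_le_one hx0 h hs2

end Cube

theorem OverlapSecondMomentLE.mono.{w, v} {V : Type v} [Fintype V] [DecidableEq V]
    {G : SimpleGraph V} [Fintype G.edgeSet] {B : Finset V} {γ : B → ℤˣ} {p : unitInterval}
    {b c : ℝ} (h : OverlapSecondMomentLE.{w} G B γ p b) (hbc : b ≤ c) :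
    OverlapSecondMomentLE.{w} G B γ p c := by
  intro Ω _ P _ J K σ σ' h1 h2 h3
  obtain ⟨hi, hle⟩ := h Ω P J K σ σ' h1 h2 h3
  exact ⟨hi, hle.trans hbc⟩

end EdwardsAnderson

end

theorem mainTheorem8 (d : ℕ) (hd : 1 ≤ d) :
    ∃ C : ℝ, 0 < C ∧
      -- usual boundary of the cube, with an arbitrary fixed boundary condition
      (∀ L : ℕ, 2 ≤ L → ∀ γ : EdwardsAnderson.cubeBoundary d L → ℤˣ,
        ∀ p : unitInterval, 0 < p → p < 1 →
          EdwardsAnderson.OverlapSecondMomentLE.{u, 0} (EdwardsAnderson.cube d L)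
            (EdwardsAnderson.cubeBoundary d L) γ p
            (if d = 1 then C * (L : ℝ)⁻¹ * (p : ℝ)⁻¹
              else C * ((L : ℝ) ^ 2)⁻¹ * ((p : ℝ) ^ 2)⁻¹)) ∧
      -- free boundary
      (∀ L : ℕ, 1 ≤ L → ∀ γ : (∅ : Finset (Fin d → Fin (L + 1))) → ℤˣ,
        ∀ p : unitInterval, 0 < p → p < 1 →
          EdwardsAnderson.OverlapSecondMomentLE.{u, 0} (EdwardsAnderson.cube d L) ∅ γ p
            (C / ((L : ℝ) ^ d * (p : ℝ) ^ d))) ∧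
      -- periodic boundary
      (∀ (L : ℕ) [NeZero L], ∀ γ : (∅ : Finset (Fin d → ZMod L)) → ℤˣ,
        ∀ p : unitInterval, 0 < p → p < 1 →
          EdwardsAnderson.OverlapSecondMomentLE.{u, 0} (EdwardsAnderson.torus d L) ∅ γ p
            (C / ((L : ℝ) ^ d * (p : ℝ) ^ d))) := by
  have : NeZero d := ⟨by omega⟩
  -- `M` is the side length in vertices: `L + 1` for the free cube, `L` for the torus.
  have hbound : ∀ (L : ℕ) (M : ℝ) (p : unitInterval), 0 < p → 0 < (L : ℝ) → (L : ℝ) ≤ M →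
      (2 * (p : ℝ)⁻¹) ^ d / M ^ d ≤
        EdwardsAnderson.overlapConstant d / ((L : ℝ) ^ d * (p : ℝ) ^ d) := by
    intro L M p hp hL hM
    have hp0 : (0 : ℝ) < p := by exact_mod_cast hp
    calc (2 * (p : ℝ)⁻¹) ^ d / M ^ d ≤ (2 * (p : ℝ)⁻¹) ^ d / (L : ℝ) ^ d := by gcongr
      _ = 2 ^ d / ((L : ℝ) ^ d * (p : ℝ) ^ d) := by
        rw [mul_pow, inv_pow]; field_simp
      _ ≤ _ := by
        gcongr
        exact EdwardsAnderson.two_pow_le_overlapConstant d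
  refine ⟨EdwardsAnderson.overlapConstant d,
    one_pos.trans_le (EdwardsAnderson.one_le_overlapConstant d), fun L hL γ p h0 h1 => ?_,
    fun L hL γ p h0 h1 => ?_, fun L _ γ p h0 h1 => ?_⟩
  · split_ifs with h
    · refine (EdwardsAnderson.overlapSecondMomentLE_cube_boundary hL γ h0 h1 hd one_le_two).mono
        (le_of_eq ?_)
      ring
    · refine (EdwardsAnderson.overlapSecondMomentLE_cube_boundary hL γ h0 h1 (s := 2) (by omega)
        le_rfl).mono (le_of_eq ?_)
      ring
  · exact (EdwardsAnderson.overlapSecondMomentLE_cube_free d L γ h0 h1).mono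
      (hbound L _ p h0 (by exact_mod_cast hL) (by linarith))
  · exact (EdwardsAnderson.overlapSecondMomentLE_torus d L γ h0 h1).mono
      (hbound L _ p h0 (by exact_mod_cast Nat.pos_of_ne_zero (NeZero.ne L)) le_rfl)
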